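/- Let $\Omega\subset\mathbb R^d$ be a bounded Lipschitz domain (open, connected, and near each boundary point the region strictly above the graph of a Lipschitz function in suitable orthonormal coordinates). Let $s_*,\bar s\in L^\infty(\Omega)$ with $s_*\ge 0$ almost everywhere. Then there is a constant $c>0$, depending only on $\Omega,s_*,\bar s$, for which the following holds. Let $x_0\in\Omega$, and let $\psi_i\in L^\infty(\Omega)$ ($i\in\mathbb N=\{1,2,\dots\}$) be such that $b_i:=\|\psi_i\|_{L^\infty(\Omega)}<C\,i^{-p}$ for all $i$, with some constants $C>0$ and $p>1$. Put $$U=\Big\{u\in\mathbb R^{\mathbb N}:\ \sum_{i\ge1}|u_i|b_i<\infty\Big\},\qquad s(x,u)=s_*(x)+\exp\Big(\bar s(x)+\sum_{i\ge1}u_i\psi_i(x)\Big),$$ and assume that $s(\cdot,u)$ is continuous on $\overline\Omega$ for every $u\in U$. Equip $U$ with the trace $\Theta$ of the product $\sigma$-algebra $\bigotimes_{i}\mathcal B(\mathbb R)$ and with the restriction $\gamma$ to $U$ of $\bigotimes_{i}\mathcal N(0,1)$. For each $u\in U$ let $T(\cdot,u)\in C(\overline\Omega)$ be the viscosity solution of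 the eikonal equation with source $x_0$ and the Soner boundary condition, $$|\nabla T(x,u)|=s(x,u),\qquad T(x_0,u)=0,\qquad \nabla T(x,u)\cdot n(x)\ge0\ \text{ on }\partial\Omega;$$ that is, $T(x_0,u)=0$ and, for every $\varphi\in C^1(\mathbb R^d)$: if $T(\cdot,u)-\varphi$ has a local maximum at $x\in\Omega\setminus\{x_0\}$, then $|\nabla\varphi(x)|\le s(x,u)$; and if $T(\cdot,u)-\varphi$ has a local minimum relative to $\overline\Omega$ at $x\in\overline\Omega\setminus\{x_0\}$, then $|\nabla\varphi(x)|\ge s(x,u)$. Then: 1. For all $x\in\overline\Omega$ and $u,v\in U$, $$|T(x,u)-T(x,v)|\le c\Big(\sum_i|u_i-v_i|b_i\Big)\Big(e^{\sum_i|u_i|b_i}+e^{\sum_i|v_i|b_i}\Big)\Big(e^{2\sum_i|u_i|b_i}+e^{2\sum_i|v_i|b_i}\Big).$$ 2. $\gamma$ is a probability measure on $(U,\Theta)$. 3. For any $N$ and any $x^1,\dots,x^N\in\overline\Omega$, the forward map $G:U\to\mathbb R^N$, $G(u)=(T(x^1,u),\dots,T(x^N,u))$, is measurable. 4. Let in addition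 $\Sigma$ be a positive definite $N\times N$ matrix, let $u\sim\gamma$ and $\vartheta\sim\mathcal N(0,\Sigma)$ be independent, $\delta=G(u)+\vartheta$, and $\Phi(u,\delta)=\frac12|\Sigma^{-1/2}(\delta-G(u))|^2$. Then the posterior $\gamma^\delta=P(u\mid\delta)$ (a regular conditional distribution of $u$ given $\delta$) exists, is unique up to a null set of data $\delta$ with respect to the law of $\delta$, and has a version such that for every $\delta\in\mathbb R^N$: $\gamma^\delta$ is absolutely continuous with respect to $\gamma$, $Z(\delta):=\int_U e^{-\Phi(w,\delta)}\,d\gamma(w)>0$, and $$\frac{d\gamma^\delta}{d\gamma}(u)=\frac{1}{Z(\delta)}\,e^{-\Phi(u,\delta)}\qquad\text{for }\gamma\text{-almost every }u\in U.$$ -/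

import Mathlib

open MeasureTheory ProbabilityTheory
open scoped ENNReal Matrix RealInnerProductSpace

namespace LogNormalEikonal

/-- Euclidean space `ℝ^d`. -/
abbrev E (d : ℕ) : Type := EuclideanSpace ℝ (Fin d)

/-- A Lipschitz domain: an open connected nonempty set which, near every boundary point, is the
open region lying strictly above the graph of a Lipschitz function, in the direction of some unit
vector `e`. Here `⟪e, x⟫` is the height of `x` in the direction `e`, and `x - ⟪e, x⟫ • e` is its
orthogonal projection onto the hyperplane `e^⊥`; only the values of `g` on `e^⊥` matter. -/
structure IsLipschitzDomain {d : ℕ} (Ω : Set (E d)) : Prop where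
  isOpen : IsOpen Ω
  isConnected : IsConnected Ω
  boundary_graph : ∀ p ∈ frontier Ω, ∃ e : E d, ‖e‖ = 1 ∧
    ∃ (K : NNReal) (g : E d → ℝ), LipschitzWith K g ∧
      ∃ r > 0, ∀ x ∈ Metric.ball p r, (x ∈ Ω ↔ g (x - ⟪e, x⟫ • e) < ⟪e, x⟫)

/-- Viscosity solutions of the eikonal equation with a point source at `x₀` and with the Soner
boundary condition:
`|∇T| = s` in `Ω \ {x₀}`, `T x₀ = 0`, `∇T · n ≥ 0` on `∂Ω`.
In the viscosity sense, `T` is continuous on the closure of `Ω`, it is a subsolution in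
`Ω \ {x₀}`, and the Soner condition says that the supersolution property holds up to the
boundary, with local minima taken relative to the closed domain. -/
structure IsEikonalSolution {d : ℕ} (Ω : Set (E d)) (x₀ : E d) (s T : E d → ℝ) : Prop where
  continuousOn : ContinuousOn T (closure Ω)
  source : T x₀ = 0
  subsolution : ∀ x ∈ Ω, x ≠ x₀ → ∀ φ : E d → ℝ, ContDiff ℝ 1 φ →
    IsLocalMaxOn (fun y => T y - φ y) Ω x → ‖gradient φ x‖ ≤ s x
  supersolution : ∀ x ∈ closure Ω, x ≠ x₀ → ∀ φ : E d → ℝ, ContDiff ℝ 1 φ →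
    IsLocalMinOn (fun y => T y - φ y) (closure Ω) x → s x ≤ ‖gradient φ x‖

/-- The norm of `f` in `L^∞(Ω)` (used for functions that are in `L^∞(Ω)`). -/
noncomputable def supNorm {d : ℕ} (Ω : Set (E d)) (f : E d → ℝ) : ℝ :=
  (eLpNorm f ∞ (volume.restrict Ω)).toReal

/-- The space `U` of the sequences `u` with `∑ |u_i| ‖ψ_i‖_{L^∞(Ω)} < ∞`. -/
def U {d : ℕ} (Ω : Set (E d)) (ψ : ℕ → E d → ℝ) : Set (ℕ → ℝ) :=
  {u | Summable fun i => |u i| * supNorm Ω (ψ i)}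

/-- The weighted norm `∑ |u_i| ‖ψ_i‖_{L^∞(Ω)}`. -/
noncomputable def wNorm {d : ℕ} (Ω : Set (E d)) (ψ : ℕ → E d → ℝ) (u : ℕ → ℝ) : ℝ :=
  ∑' i, |u i| * supNorm Ω (ψ i)

/-- The log-normal slowness `s(x,u) = s_*(x) + exp(s̄(x) + ∑ u_i ψ_i(x))`. -/
noncomputable def slowness {d : ℕ} (sstar sbar : E d → ℝ) (ψ : ℕ → E d → ℝ)
    (x : E d) (u : ℕ → ℝ) : ℝ :=
  sstar x + Real.exp (sbar x + ∑' i, u i * ψ i x)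

/-- The prior: the restriction to `U` (with the trace of the product `σ`-algebra) of the
countable product of standard normal distributions. -/
noncomputable def prior {d : ℕ} (Ω : Set (E d)) (ψ : ℕ → E d → ℝ) : Measure (U Ω ψ) :=
  (Measure.infinitePi fun _ : ℕ => gaussianReal 0 1).comap Subtype.val

/-- The forward map `G(u) = (T(x^1,u), …, T(x^N,u))`. -/
noncomputable def forwardMap {d N : ℕ} {V : Type*} (T : E d → V → ℝ) (obs : Fin N → E d) (u : V) :
    E N :=
  WithLp.toLp 2 fun i => T (obs i) u

/-- The mismatch function
`Φ(u,δ) = ½ |Σ^{-1/2}(δ - G(u))|² = ½ (δ - G(u))ᵀ Σ⁻¹ (δ - G(u))`. -/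
noncomputable def misfit {N : ℕ} {V : Type*} (Cov : Matrix (Fin N) (Fin N) ℝ) (G : V → E N)
    (u : V) (δ : E N) : ℝ :=
  (1 / 2) * ((δ - G u).ofLp ⬝ᵥ (Cov⁻¹ *ᵥ (δ - G u).ofLp))

/-- The joint law of `(δ, u)` where `δ = G(u) + ϑ`, the unknown `u` has law `μ`, and the noise
`ϑ ∼ N(0, Cov)` is independent of `u`. -/
noncomputable def jointLaw {N : ℕ} {V : Type*} [MeasurableSpace V] (μ : Measure V)
    (Cov : Matrix (Fin N) (Fin N) ℝ) (G : V → E N) : Measure (E N × V) :=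
  (μ.prod (multivariateGaussian 0 Cov)).map fun q => (G q.1 + q.2, q.1)

/-- `κ` is (a version of) the posterior `δ ↦ P(u | δ)`: a regular conditional distribution of `u`
given the data `δ = G(u) + ϑ`. -/
def IsPosterior {N : ℕ} {V : Type*} [MeasurableSpace V] (μ : Measure V)
    (Cov : Matrix (Fin N) (Fin N) ℝ) (G : V → E N) (κ : Kernel (E N) V) : Prop :=
  IsMarkovKernel κ ∧ (jointLaw μ Cov G).fst ⊗ₘ κ = jointLaw μ Cov G

end LogNormalEikonal

/-!
The forward problem is controlled by a comparison principle on the closed domain. If `T` solves the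
eikonal equation with slowness `s`, `T'` solves it with slowness `s'`, and `s < s'` on `closure Ω`,
then `T ≤ T'` (`IsEikonalSolution.le_of_lt`). The proof doubles the variables at a positive maximum
`z` of `T - T'`, with the penalization `|x - y - ε e|² / ε² + |y - z|²`. A Lipschitz domain contains
a cone in the direction `e` over every point of its closure near `z`
(`IsLipschitzDomain.exists_cone`), so the maximizing `x` is an interior point, where `T` is a
subsolution, while `T'` is a supersolution at `y` even on the boundary. Both test functions have
almost the same gradient there, which contradicts `s < s'`.

Since the equation is homogeneous, comparison gives `T ≤ λ T'` as soon as `s ≤ λ s'`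
(`IsEikonalSolution.le_mul`). With `λ = 1 + ‖s - s'‖_∞ / min s'` the difference `T - T'` is at most
`‖s - s'‖_∞ / min s'` times `T'`. A subsolution is Lipschitz, with constant `sup s'`, along each
segment contained in `Ω`, and by connectedness and compactness a function with this property
oscillates by at most `C(Ω) sup s'` (`IsLipschitzDomain.exists_osc_bound`), so `T'` is bounded. The
elementary bounds of the log-normal slowness then yield the stability estimate
(`exists_stability_constant`).

The prior gives full measure to `U` because `E ∑ |u_i| b_i < ∞` (`ae_mem_U`). The travel time is
measurable in the parameter because it is the limit of its values at truncated sequences, which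
depend continuously on finitely many coordinates (`measurable_of_stability`). The Gaussian noise has
a Lebesgue density, so the joint law of data and parameter has the density `k e^{-Φ}` with respect
to the product of the Lebesgue measure and the prior. Normalizing it in the parameter gives the
posterior, and disintegrations with respect to the first marginal are unique almost everywhere
(`exists_posterior`).
-/

namespace LogNormalEikonal

open Filter Topology Metric

variable {d : ℕ}

/-! ### Geometry of Lipschitz domains -/

/-- Uniform interior cone property: near a point `z` of the closed domain, all points of the closed
domain are vertices of truncated open cones with a common axis `e` that lie in the domain. -/
lemma IsLipschitzDomain.exists_cone {Ω : Set (E d)} (hΩ : IsLipschitzDomain Ω) {z : E d}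
    (hz : z ∈ closure Ω) :
    ∃ (e : E d) (κ r : ℝ), 0 < κ ∧ 0 < r ∧ ∀ y ∈ closure Ω, dist y z < r → ∀ t, 0 < t → t < r →
      ball (y + t • e) (κ * t) ⊆ Ω := by
  by_cases hzΩ : z ∈ Ω
  · obtain ⟨R, hR, hball⟩ := Metric.isOpen_iff.1 hΩ.isOpen z hzΩ
    refine ⟨0, 1, R / 2, one_pos, by positivity, fun y _ hyz t _ ht w hw => hball ?_⟩
    simp only [smul_zero, add_zero, one_mul, mem_ball] at hw ⊢
    linarith [dist_triangle w y z]
  obtain ⟨e, he, K, g, hg, ρ, hρ, hgraph⟩ :=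
    hΩ.boundary_graph z ⟨hz, fun h => hzΩ (interior_subset h)⟩
  have hK : (0 : ℝ) < 2 * K + 1 := by positivity
  have hκ1 : 1 / (2 * (K : ℝ) + 1) ≤ 1 := by
    rw [div_le_one hK]
    linarith [K.coe_nonneg]
  -- moving by `t • e + v` raises the height by at least `t - ‖v‖`, and raises the graph by at most
  -- `2 * K * ‖v‖`, so the aperture `1 / (2 * K + 1)` is admissible
  refine ⟨e, 1 / (2 * K + 1), ρ / 3, by positivity, by positivity, ?_⟩
  -- first for base points in the open set
  have main : ∀ y ∈ Ω, dist y z < ρ / 3 → ∀ t, 0 < t → t < ρ / 3 →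
      ball (y + t • e) (1 / (2 * K + 1) * t) ⊆ Ω := by
    intro y hy hyz t ht0 ht w hw
    set κ : ℝ := 1 / (2 * K + 1) with hκ
    obtain ⟨v, rfl⟩ : ∃ v, w = y + t • e + v := ⟨w - (y + t • e), by abel⟩
    rw [mem_ball, dist_eq_norm, add_sub_cancel_left] at hw
    have hte : ‖t • e‖ = t := by rw [norm_smul, he, mul_one, Real.norm_of_nonneg ht0.le]
    have hκt : κ * t ≤ t := mul_le_of_le_one_left ht0.le hκ1
    have hyb : y ∈ ball z ρ := by rw [mem_ball]; linarith
    have hwb : y + t • e + v ∈ ball z ρ := by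
      rw [mem_ball, dist_eq_norm, show y + t • e + v - z = (y - z) + t • e + v by abel]
      have := norm_add₃_le (a := y - z) (b := t • e) (c := v)
      rw [dist_eq_norm] at hyz
      linarith
    rw [hgraph _ hwb]
    have h1 := (hgraph y hyb).1 hy
    have hee : ⟪e, e⟫ = 1 := by rw [real_inner_self_eq_norm_sq, he, one_pow]
    have hin : ⟪e, y + t • e + v⟫ = ⟪e, y⟫ + t + ⟪e, v⟫ := by
      rw [inner_add_right, inner_add_right, inner_smul_right, hee, mul_one]
    have hve : |⟪e, v⟫| ≤ ‖v‖ := by simpa [he] using abs_real_inner_le_norm e v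
    have h2 : dist (y + t • e + v - ⟪e, y + t • e + v⟫ • e) (y - ⟪e, y⟫ • e) ≤ 2 * ‖v‖ := by
      rw [hin, dist_eq_norm, show y + t • e + v - (⟪e, y⟫ + t + ⟪e, v⟫) • e - (y - ⟪e, y⟫ • e)
        = v - ⟪e, v⟫ • e by module]
      refine (norm_sub_le _ _).trans ?_
      rw [norm_smul, he, mul_one, Real.norm_eq_abs]
      linarith
    have h3 := (le_abs_self _).trans (hg.dist_le_mul (y + t • e + v - ⟪e, y + t • e + v⟫ • e)
      (y - ⟪e, y⟫ • e))
    have h4 := mul_le_mul_of_nonneg_left h2 K.coe_nonneg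
    have h5 : (2 * K + 1) * ‖v‖ < t := by
      calc (2 * K + 1) * ‖v‖ < (2 * K + 1) * (κ * t) := by gcongr
        _ = t := by rw [hκ]; field_simp
    rw [hin] at h3 h4 ⊢
    linarith [neg_le_of_abs_le hve]
  -- a boundary base point is approximated by points of the open set
  intro y hy hyz t ht0 ht w hw
  have hev : ∀ᶠ y' in 𝓝 y, dist y' z < ρ / 3 ∧ w ∈ ball (y' + t • e) (1 / (2 * K + 1) * t) := by
    refine ((continuous_id.dist continuous_const).tendsto y |>.eventually_lt_const hyz).and ?_
    simp only [mem_ball] at hw ⊢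
    exact ((continuous_const.dist (continuous_id.add continuous_const)).tendsto y
      |>.eventually_lt_const hw)
  obtain ⟨y', hy', h1, h2⟩ := ((mem_closure_iff_frequently.1 hy).and_eventually hev).exists
  exact main y' hy' h1 t ht0 ht h2

/-- The intrinsic diameter of a bounded Lipschitz domain is finite, in a form that avoids paths:
functions that are `L`-Lipschitz along all segments in the domain oscillate by at most `C * L`. -/
lemma IsLipschitzDomain.exists_osc_bound {Ω : Set (E d)} (hΩ : IsLipschitzDomain Ω)
    (hbdd : Bornology.IsBounded Ω) :
    ∃ C : ℝ, 0 ≤ C ∧ ∀ (f : E d → ℝ) (L : ℝ), 0 ≤ L →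
      (∀ a b, segment ℝ a b ⊆ Ω → |f a - f b| ≤ L * ‖a - b‖) →
      ∀ x ∈ Ω, ∀ y ∈ Ω, |f x - f y| ≤ C * L := by
  -- near each point of the closed domain the oscillation is bounded: two points are joined by
  -- moving both in the direction of the cone axis and then along a segment
  have hloc : ∀ z ∈ closure Ω, ∃ δ > 0, ∃ C : ℝ, 0 ≤ C ∧ ∀ (f : E d → ℝ) (L : ℝ), 0 ≤ L →
      (∀ a b, segment ℝ a b ⊆ Ω → |f a - f b| ≤ L * ‖a - b‖) →
      ∀ x ∈ ball z δ ∩ Ω, ∀ y ∈ ball z δ ∩ Ω, |f x - f y| ≤ C * L := by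
    intro z hz
    obtain ⟨e, κ, r, hκ, hr, hcone⟩ := hΩ.exists_cone hz
    set t := r / 2 with ht
    have ht0 : 0 < t := by positivity
    refine ⟨min r (κ * t), by positivity, 2 * (t * ‖e‖) + 2 * (κ * t), by positivity,
      fun f L hL hf x hx y hy => ?_⟩
    have hup : ∀ x ∈ ball z (min r (κ * t)) ∩ Ω, |f x - f (x + t • e)| ≤ L * (t * ‖e‖) := by
      intro x hx
      have hseg : segment ℝ x (x + t • e) ⊆ Ω := by
        rw [segment_eq_image']
        rintro _ ⟨θ, ⟨h0, h1⟩, rfl⟩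
        rcases h0.eq_or_lt with rfl | h0
        · simpa using hx.2
        have hxr : dist x z < r := (mem_ball.1 hx.1).trans_le (min_le_left _ _)
        have hθt : 0 < θ * t := by positivity
        refine hcone x (subset_closure hx.2) hxr (θ * t) hθt ?_ ?_
        · calc θ * t ≤ 1 * t := by gcongr
            _ < r := by rw [ht]; linarith
        · simp only [add_sub_cancel_left, smul_smul]
          exact mem_ball_self (by positivity)
      have := hf _ _ hseg
      rwa [sub_add_cancel_left, norm_neg, norm_smul, Real.norm_of_nonneg ht0.le] at this
    have hmem : ∀ x ∈ ball z (min r (κ * t)) ∩ Ω, x + t • e ∈ ball (z + t • e) (κ * t) := by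
      intro x hx
      rw [mem_ball, dist_add_right]
      exact (mem_ball.1 hx.1).trans_le (min_le_right _ _)
    have hmid : |f (x + t • e) - f (y + t • e)| ≤ L * (2 * (κ * t)) := by
      refine (hf _ _ (((convex_ball _ _).segment_subset (hmem x hx) (hmem y hy)).trans
        (hcone z hz (by simpa using hr) t ht0 (by rw [ht]; linarith)))).trans ?_
      gcongr
      rw [← dist_eq_norm]
      have h1 := mem_ball.1 (hmem x hx)
      have h2 := mem_ball'.1 (hmem y hy)
      linarith [dist_triangle (x + t • e) (z + t • e) (y + t • e)]
    have h1 := hup x hx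
    have h2 := hup y hy
    calc |f x - f y| = |(f x - f (x + t • e)) + (f (x + t • e) - f (y + t • e))
          - (f y - f (y + t • e))| := by congr 1; ring
      _ ≤ |f x - f (x + t • e)| + |f (x + t • e) - f (y + t • e)| + |f y - f (y + t • e)| :=
          (abs_sub _ _).trans (by gcongr; exact abs_add_le _ _)
      _ ≤ _ := by linarith
  obtain ⟨x₁, hx₁⟩ := hΩ.isConnected.nonempty
  -- by connectedness any two points have values at bounded distance
  have hpt : ∀ y ∈ Ω, ∃ C : ℝ, 0 ≤ C ∧ ∀ (f : E d → ℝ) (L : ℝ), 0 ≤ L →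
      (∀ a b, segment ℝ a b ⊆ Ω → |f a - f b| ≤ L * ‖a - b‖) → |f x₁ - f y| ≤ C * L := by
    intro y hy
    refine hΩ.isConnected.isPreconnected.induction₂ (fun x y => ∃ C : ℝ, 0 ≤ C ∧
      ∀ (f : E d → ℝ) (L : ℝ), 0 ≤ L → (∀ a b, segment ℝ a b ⊆ Ω → |f a - f b| ≤ L * ‖a - b‖) →
      |f x - f y| ≤ C * L) ?_ ?_ ?_ hx₁ hy
    · intro x hx
      obtain ⟨δ, hδ, C, hC, h⟩ := hloc x (subset_closure hx)
      filter_upwards [self_mem_nhdsWithin, mem_nhdsWithin_of_mem_nhds (ball_mem_nhds x hδ)]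
        with y hyΩ hy
      exact ⟨C, hC, fun f L hL hf => h f L hL hf x ⟨mem_ball_self hδ, hx⟩ y ⟨hy, hyΩ⟩⟩
    · rintro x y w - - - ⟨C, hC, h⟩ ⟨C', hC', h'⟩
      refine ⟨C + C', by positivity, fun f L hL hf => ?_⟩
      linarith [abs_sub_le (f x) (f y) (f w), h f L hL hf, h' f L hL hf]
    · rintro x y - - ⟨C, hC, h⟩
      exact ⟨C, hC, fun f L hL hf => by rw [abs_sub_comm]; exact h f L hL hf⟩
  -- by compactness the bound is uniform
  have hcpt : ∃ C : ℝ, 0 ≤ C ∧ ∀ (f : E d → ℝ) (L : ℝ), 0 ≤ L →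
      (∀ a b, segment ℝ a b ⊆ Ω → |f a - f b| ≤ L * ‖a - b‖) →
      ∀ y ∈ closure Ω, y ∈ Ω → |f x₁ - f y| ≤ C * L := by
    refine hbdd.isCompact_closure.induction_on (p := fun S => ∃ C : ℝ, 0 ≤ C ∧
      ∀ (f : E d → ℝ) (L : ℝ), 0 ≤ L → (∀ a b, segment ℝ a b ⊆ Ω → |f a - f b| ≤ L * ‖a - b‖) →
      ∀ y ∈ S, y ∈ Ω → |f x₁ - f y| ≤ C * L) ?_ ?_ ?_ ?_
    · exact ⟨0, le_rfl, by simp⟩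
    · rintro S S' hS ⟨C, hC, h⟩
      exact ⟨C, hC, fun f L hL hf y hy => h f L hL hf y (hS hy)⟩
    · rintro S S' ⟨C, hC, h⟩ ⟨C', hC', h'⟩
      refine ⟨max C C', by positivity, fun f L hL hf y hy hyΩ => ?_⟩
      rcases hy with hy | hy
      · exact (h f L hL hf y hy hyΩ).trans (by gcongr; exact le_max_left _ _)
      · exact (h' f L hL hf y hy hyΩ).trans (by gcongr; exact le_max_right _ _)
    · intro z hz
      obtain ⟨δ, hδ, C, hC, h⟩ := hloc z hz
      obtain ⟨w, hwΩ, hw⟩ := Metric.mem_closure_iff.1 hz δ hδ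
      obtain ⟨C', hC', h'⟩ := hpt w hwΩ
      refine ⟨ball z δ, mem_nhdsWithin_of_mem_nhds (ball_mem_nhds z hδ), C' + C, by positivity,
        fun f L hL hf y hy hyΩ => ?_⟩
      have h1 := h f L hL hf w ⟨mem_ball'.2 hw, hwΩ⟩ y ⟨hy, hyΩ⟩
      linarith [abs_sub_le (f x₁) (f w) (f y), h' f L hL hf]
  obtain ⟨C, hC, h⟩ := hcpt
  refine ⟨2 * C, by positivity, fun f L hL hf x hx y hy => ?_⟩
  have h1 := h f L hL hf x (subset_closure hx) hx
  have h2 := h f L hL hf y (subset_closure hy) hy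
  rw [abs_sub_comm] at h1
  linarith [abs_sub_le (f x) (f x₁) (f y)]

/-! ### Eikonal subsolutions are Lipschitz along segments -/

lemma contDiff_sq_dist_add (α β : ℝ) (p q : E d) :
    ContDiff ℝ 1 fun y : E d => α * ‖y - p‖ ^ 2 + β * ‖y - q‖ ^ 2 := by
  have h (w : E d) : ContDiff ℝ 1 fun y : E d => ‖y - w‖ ^ 2 :=
    (contDiff_id.sub contDiff_const).norm_sq ℝ
  exact (contDiff_const.mul (h p)).add (contDiff_const.mul (h q))

lemma gradient_sq_dist_add (α β : ℝ) (p q x : E d) :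
    gradient (fun y : E d => α * ‖y - p‖ ^ 2 + β * ‖y - q‖ ^ 2) x =
      (2 * α) • (x - p) + (2 * β) • (x - q) := by
  have h (w : E d) : HasFDerivAt (fun y : E d => ‖y - w‖ ^ 2) (2 • innerSL ℝ (x - w)) x := by
    simpa using ((hasFDerivAt_id x).sub_const w).norm_sq
  apply HasGradientAt.gradient
  rw [hasGradientAt_iff_hasFDerivAt]
  refine (((h p).const_mul α).add ((h q).const_mul β)).congr_fderiv ?_
  ext y
  simp
  ring

lemma norm_gradient_const_mul {φ : E d → ℝ} (hφ : ContDiff ℝ 1 φ) {l : ℝ} (hl : 0 ≤ l) (x : E d) :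
    ‖gradient (fun y => l * φ y) x‖ = l * ‖gradient φ x‖ := by
  have hd : DifferentiableAt ℝ φ x := (hφ.differentiable one_ne_zero) x
  have h : gradient (fun y => l * φ y) x = l • gradient φ x :=
    (hasGradientAt_iff_hasFDerivAt.2 (by
      simpa using (hasGradientAt_iff_hasFDerivAt.1 hd.hasGradientAt).const_mul l)).gradient
  rw [h, norm_smul, Real.norm_of_nonneg hl]

/-- The eikonal equation is homogeneous of degree one. -/
lemma IsEikonalSolution.const_mul {Ω : Set (E d)} {x₀ : E d} {s T : E d → ℝ}
    (h : IsEikonalSolution Ω x₀ s T) {l : ℝ} (hl : 0 < l) :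
    IsEikonalSolution Ω x₀ (fun x => l * s x) (fun x => l * T x) where
  continuousOn := continuousOn_const.mul h.continuousOn
  source := by rw [h.source, mul_zero]
  subsolution x hx hne φ hφ hmax := by
    have h1 := h.subsolution x hx hne (fun y => l⁻¹ * φ y) (contDiff_const.mul hφ) (by
      filter_upwards [hmax] with y hy
      have := mul_le_mul_of_nonneg_left hy (inv_nonneg.2 hl.le)
      rwa [mul_sub, mul_sub, inv_mul_cancel_left₀ hl.ne', inv_mul_cancel_left₀ hl.ne'] at this)
    rwa [norm_gradient_const_mul hφ (inv_nonneg.2 hl.le), inv_mul_le_iff₀ hl] at h1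
  supersolution x hx hne φ hφ hmin := by
    have h1 := h.supersolution x hx hne (fun y => l⁻¹ * φ y) (contDiff_const.mul hφ) (by
      filter_upwards [hmin] with y hy
      have := mul_le_mul_of_nonneg_left hy (inv_nonneg.2 hl.le)
      rwa [mul_sub, mul_sub, inv_mul_cancel_left₀ hl.ne', inv_mul_cancel_left₀ hl.ne'] at this)
    rwa [norm_gradient_const_mul hφ (inv_nonneg.2 hl.le), le_inv_mul_iff₀ hl] at h1

/-- A subsolution grows at most with slope `M'` away from each point, up to a quadratic term, when
`M'` exceeds the bound `M` of the slowness. Comparison with the right-hand side, where `K` is so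
large that the maximum of the difference is not attained on the sphere of radius `R`. At the centre
no viscosity inequality is needed, so the source is allowed as centre. -/
lemma IsEikonalSolution.exists_growth_bound {Ω : Set (E d)} (hΩ : IsOpen Ω) {x₀ : E d}
    {s T : E d → ℝ} (h : IsEikonalSolution Ω x₀ s T) {M M' : ℝ} (hM : 0 ≤ M) (hMM' : M < M')
    (hs : ∀ x ∈ Ω, s x ≤ M) {a : E d} (ha : a ∈ Ω) :
    ∃ K, 0 ≤ K ∧ ∃ R > 0, ∀ x ∈ closedBall a R, T x - T a ≤ M' * ‖x - a‖ + K * ‖x - a‖ ^ 2 := by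
  obtain ⟨R, hR, hRΩ, hRx₀⟩ : ∃ R > 0, closedBall a R ⊆ Ω ∧ ∀ x ∈ closedBall a R, x ≠ a →
      x ≠ x₀ := by
    obtain ⟨R, hR, hRΩ⟩ := Metric.nhds_basis_closedBall.mem_iff.1 (hΩ.mem_nhds ha)
    by_cases hax : a = x₀
    · exact ⟨R, hR, hRΩ, fun x _ hx => hax ▸ hx⟩
    · have hpos : 0 < dist x₀ a := dist_pos.2 (Ne.symm hax)
      refine ⟨min R (dist x₀ a / 2), by positivity,
        (closedBall_subset_closedBall (min_le_left _ _)).trans hRΩ, ?_⟩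
      rintro x hx - rfl
      have := (mem_closedBall.1 hx).trans (min_le_right _ _)
      linarith
  have hcont : ContinuousOn T (closedBall a R) :=
    h.continuousOn.mono (hRΩ.trans subset_closure)
  obtain ⟨B, hB⟩ := (isCompact_closedBall a R).exists_bound_of_continuousOn hcont
  simp only [Real.norm_eq_abs] at hB
  have haR : a ∈ closedBall a R := mem_closedBall_self hR.le
  have hB0 : 0 ≤ B := (abs_nonneg _).trans (hB a haR)
  set K := (2 * B + 1) / R ^ 2 with hK
  have hK0 : 0 ≤ K := by positivity
  refine ⟨K, hK0, R, hR, ?_⟩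
  set φ : E d → ℝ := fun y => M' * ‖y - a‖ + K * ‖y - a‖ ^ 2 with hφ
  have hφc : Continuous φ := by fun_prop
  obtain ⟨x, hx, hmax⟩ := (isCompact_closedBall a R).exists_isMaxOn ⟨a, haR⟩
    (hcont.sub hφc.continuousOn)
  have hmax' : ∀ y ∈ closedBall a R, T y - φ y ≤ T x - φ x := fun y hy => hmax hy
  have hφa : φ a = 0 := by simp [hφ]
  by_cases hxa : x = a
  · intro y hy
    have := hmax' y hy
    rw [hxa, hφa] at this
    simp only [hφ] at this
    linarith
  exfalso
  have hr0 : 0 < ‖x - a‖ := norm_pos_iff.2 (sub_ne_zero.2 hxa)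
  have hlt : ‖x - a‖ < R := by
    refine lt_of_le_of_ne (by simpa [dist_eq_norm] using hx) fun heq => ?_
    have h1 := hmax' a haR
    have h2 : φ x = M' * R + (2 * B + 1) := by
      simp only [hφ, heq, hK]
      field_simp
    rw [hφa, h2] at h1
    have h3 := (abs_le.1 (hB x hx)).2
    have h4 := (abs_le.1 (hB a haR)).1
    have h5 : 0 ≤ M' * R := by nlinarith
    linarith
  -- `‖y - a‖ ≤ (‖y - a‖² / r + r) / 2`, with equality for `‖y - a‖ = r`, makes `φ` smooth
  set r := ‖x - a‖ with hr
  set α := M' / (2 * r) + K with hα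
  have hα0 : 0 ≤ α := by
    have : 0 ≤ M' := hM.trans hMM'.le
    positivity
  have htouch : ∀ y, φ y ≤ α * ‖y - a‖ ^ 2 + M' * r / 2 := by
    intro y
    have h0 : 0 ≤ M' * (‖y - a‖ - r) ^ 2 / (2 * r) := by
      have : 0 ≤ M' := hM.trans hMM'.le
      positivity
    have h1 : α * ‖y - a‖ ^ 2 + M' * r / 2 - φ y = M' * (‖y - a‖ - r) ^ 2 / (2 * r) := by
      simp only [hφ, hα]
      field_simp
      ring
    linarith
  have heqx : φ x = α * r ^ 2 + M' * r / 2 := by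
    simp only [hφ, hα, ← hr]
    field_simp
    ring
  have hsub := h.subsolution x (hRΩ hx) (hRx₀ x hx hxa) _ (contDiff_sq_dist_add α 0 a a) (by
    have hnhds : closedBall a R ∈ 𝓝 x :=
      mem_of_superset (isOpen_ball.mem_nhds (by simpa [dist_eq_norm] using hlt))
        ball_subset_closedBall
    filter_upwards [mem_nhdsWithin_of_mem_nhds hnhds] with y hy
    have h1 := hmax' y hy
    have h2 := htouch y
    rw [← hr]
    linarith)
  rw [gradient_sq_dist_add, mul_zero, zero_smul, add_zero, norm_smul, ← hr,
    Real.norm_of_nonneg (by positivity)] at hsub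
  have h1 : 2 * α * r = M' + 2 * K * r := by
    rw [hα]
    field_simp
  have h2 : 0 ≤ 2 * K * r := by positivity
  linarith [hs x (hRΩ hx)]

/-- A subsolution with slowness at most `M` is `M`-Lipschitz along the segments in the domain, also
along those through the source. -/
lemma IsEikonalSolution.abs_sub_le_of_segment {Ω : Set (E d)} (hΩ : IsOpen Ω) {x₀ : E d}
    {s T : E d → ℝ} (h : IsEikonalSolution Ω x₀ s T) {M : ℝ} (hM : 0 ≤ M)
    (hs : ∀ x ∈ Ω, s x ≤ M) {a b : E d} (hab : segment ℝ a b ⊆ Ω) :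
    |T a - T b| ≤ M * ‖a - b‖ := by
  -- a bound for a slightly larger constant, by integrating the growth bound along the segment
  have key : ∀ a b : E d, segment ℝ a b ⊆ Ω → ∀ M' > M, T b - T a ≤ M' * ‖a - b‖ := by
    intro a b hab M' hM'
    set γ : ℝ → E d := fun t => a + t • (b - a) with hγ
    have hγc : Continuous γ := by fun_prop
    have hγΩ : ∀ t ∈ Set.Icc (0 : ℝ) 1, γ t ∈ Ω := fun t ht => hab (by
      rw [segment_eq_image']
      exact ⟨t, ht, rfl⟩)
    have hd : ∀ t u : ℝ, ‖γ u - γ t‖ = |u - t| * ‖a - b‖ := by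
      intro t u
      rw [show γ u - γ t = (u - t) • (b - a) by simp only [hγ]; module, norm_smul,
        Real.norm_eq_abs, norm_sub_rev]
    have hB : ∀ ⦃t⦄, t ∈ Set.Icc (0 : ℝ) 1 → T (γ t) ≤ T (γ 0) + (M' * ‖a - b‖) * t := by
      refine image_le_of_liminf_slope_right_le_deriv_boundary
        (f := fun t => T (γ t)) (B' := fun _ => M' * ‖a - b‖)
        (h.continuousOn.comp hγc.continuousOn fun t ht => subset_closure (hγΩ t ht))
        (by simp) (by fun_prop) (fun t _ => ?_) (fun t ht r hr => ?_)
      · simpa using (((hasDerivAt_id t).const_mul (M' * ‖a - b‖)).const_add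
          (T (γ 0))).hasDerivWithinAt
      · obtain ⟨K, hK, R, hR, hgrow⟩ := h.exists_growth_bound hΩ hM hM' hs
          (hγΩ t ⟨ht.1, ht.2.le⟩)
        apply Eventually.frequently
        have h1 : ∀ᶠ u in 𝓝 t, γ u ∈ closedBall (γ t) R :=
          hγc.continuousAt.eventually (closedBall_mem_nhds _ hR)
        have h2 : ∀ᶠ u in 𝓝 t, M' * ‖a - b‖ + K * ‖a - b‖ ^ 2 * (u - t) < r := by
          have : ContinuousAt (fun u => M' * ‖a - b‖ + K * ‖a - b‖ ^ 2 * (u - t)) t := by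
            fun_prop
          exact this.eventually_lt_const (by simpa using hr)
        filter_upwards [self_mem_nhdsWithin, mem_nhdsWithin_of_mem_nhds h1,
          mem_nhdsWithin_of_mem_nhds h2] with u hu hu1 hu2
        have hut : 0 < u - t := sub_pos.2 hu
        rw [slope_def_field, div_lt_iff₀ hut]
        have h3 := hgrow _ hu1
        rw [hd, abs_of_pos hut] at h3
        have h4 := mul_lt_mul_of_pos_right hu2 hut
        nlinarith
    have := hB (Set.right_mem_Icc.2 zero_le_one)
    simp only [hγ, one_smul, zero_smul, add_zero, add_sub_cancel, mul_one] at this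
    linarith
  have key' : ∀ a b : E d, segment ℝ a b ⊆ Ω → T b - T a ≤ M * ‖a - b‖ := by
    intro a b hab
    have hc : Tendsto (fun M' => M' * ‖a - b‖) (𝓝[>] M) (𝓝 (M * ‖a - b‖)) :=
      ((continuous_id.mul continuous_const).tendsto M).mono_left nhdsWithin_le_nhds
    exact ge_of_tendsto hc (eventually_mem_nhdsWithin.mono fun M' hM' => key a b hab M' hM')
  rw [abs_sub_le_iff]
  refine ⟨?_, key' a b hab⟩
  rw [norm_sub_rev]
  exact key' b a (segment_symm ℝ a b ▸ hab)

/-! ### Comparison on the closed domain -/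

/-- Comparison principle for strictly ordered slownesses. At a positive maximum of `T - T'`
the subsolution property of `T` is applied at an interior point and the supersolution property of
`T'` at a point that may lie on the boundary. -/
theorem IsEikonalSolution.le_of_lt {Ω : Set (E d)} (hΩ : IsLipschitzDomain Ω)
    (hbdd : Bornology.IsBounded Ω) {x₀ : E d} {s s' T T' : E d → ℝ}
    (h : IsEikonalSolution Ω x₀ s T) (h' : IsEikonalSolution Ω x₀ s' T')
    (hs : ContinuousOn s (closure Ω)) (hs' : ContinuousOn s' (closure Ω))
    (hlt : ∀ x ∈ closure Ω, s x < s' x) : ∀ x ∈ closure Ω, T x ≤ T' x := by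
  have hK : IsCompact (closure Ω) := hbdd.isCompact_closure
  obtain ⟨z, hz, hzmax⟩ := hK.exists_isMaxOn hΩ.isConnected.nonempty.closure
    (h.continuousOn.sub h'.continuousOn)
  have hzmax' : ∀ y ∈ closure Ω, T y - T' y ≤ T z - T' z := fun y hy => hzmax hy
  by_contra! hcon
  obtain ⟨x₁, hx₁, hcon⟩ := hcon
  set m := T z - T' z with hm
  have hm0 : 0 < m := by linarith [hzmax' x₁ hx₁]
  have hzx₀ : z ≠ x₀ := by
    rintro rfl
    rw [hm, h.source, h'.source, sub_zero] at hm0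
    exact lt_irrefl _ hm0
  obtain ⟨e, κ, r, hκ, hr, hcone⟩ := hΩ.exists_cone hz
  -- a radius on which the strict inequality between the slownesses persists
  obtain ⟨ρ, hρ, hρr, hρx₀, hρs⟩ : ∃ ρ > 0, ρ ≤ r ∧ ρ ≤ dist z x₀ ∧
      ∀ x ∈ closure Ω, ∀ y ∈ closure Ω, dist x z < ρ → dist y z < ρ → s x + 2 * ρ < s' y := by
    set δ := (s' z - s z) / 4 with hδ
    have hδ0 : 0 < δ := by have := hlt z hz; rw [hδ]; linarith
    obtain ⟨r₁, hr₁, h₁⟩ := Metric.continuousOn_iff.1 hs z hz δ hδ0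
    obtain ⟨r₂, hr₂, h₂⟩ := Metric.continuousOn_iff.1 hs' z hz δ hδ0
    have hd : 0 < dist z x₀ := dist_pos.2 hzx₀
    refine ⟨min (min r₁ r₂) (min δ (min r (dist z x₀))), by positivity, by simp, by simp,
      fun x hx y hy hxz hyz => ?_⟩
    have h3 := h₁ x hx (hxz.trans_le (by simp))
    have h4 := h₂ y hy (hyz.trans_le (by simp))
    rw [Real.dist_eq, abs_lt] at h3 h4
    have h5 : min (min r₁ r₂) (min δ (min r (dist z x₀))) ≤ δ := by simp
    linarith
  obtain ⟨B, hB⟩ := hK.exists_bound_of_continuousOn h.continuousOn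
  obtain ⟨B', hB'⟩ := hK.exists_bound_of_continuousOn h'.continuousOn
  simp only [Real.norm_eq_abs] at hB hB'
  -- a penalization below `η` puts `x` into the cone with vertex `y`, and `y` close to `z`
  set η := min (κ ^ 2) (ρ ^ 2 / 16) with hη
  have hη0 : 0 < η := by positivity
  obtain ⟨ω, hω, hTω⟩ := Metric.uniformContinuousOn_iff.1
    (hK.uniformContinuousOn_of_continuous h.continuousOn) (η / 2) (by positivity)
  -- `A` bounds the square root of the penalization a priori, hence `dist x y` is of order `ε`
  set A := √(B + B' + η) with hA
  obtain ⟨ε, hε0, hε1, hε2, hε3⟩ : ∃ ε : ℝ, 0 < ε ∧ ε < r ∧ ε * (‖e‖ + A) < ω ∧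
      ε * (‖e‖ + κ) < ρ / 2 := by
    have hc (c : ℝ) (b : ℝ) (hb : 0 < b) : ∀ᶠ ε : ℝ in 𝓝[>] 0, ε * c < b := by
      have : ContinuousAt (fun ε : ℝ => ε * c) 0 := by fun_prop
      exact (this.eventually_lt_const (by simpa using hb)).filter_mono nhdsWithin_le_nhds
    obtain ⟨ε, h0, h1, h2, h3⟩ := (eventually_mem_nhdsWithin.and ((hc 1 r hr).and
      ((hc (‖e‖ + A) ω hω).and (hc (‖e‖ + κ) (ρ / 2) (by positivity))))).exists
    exact ⟨ε, h0, by simpa using h1, h2, h3⟩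
  -- doubling of the variables, with `x` shifted into the domain
  set Φ : E d × E d → ℝ := fun p =>
    T p.1 - T' p.2 - (‖p.1 - p.2 - ε • e‖ ^ 2 / ε ^ 2 + ‖p.2 - z‖ ^ 2) with hΦ
  have hΦc : ContinuousOn Φ (closure Ω ×ˢ closure Ω) := by
    refine ((h.continuousOn.comp continuousOn_fst fun p hp => hp.1).sub
      (h'.continuousOn.comp continuousOn_snd fun p hp => hp.2)).sub ?_
    fun_prop
  obtain ⟨⟨x, y⟩, ⟨hx, hy⟩, hxy⟩ := (hK.prod hK).exists_isMaxOn
    (hΩ.isConnected.nonempty.closure.prod hΩ.isConnected.nonempty.closure) hΦc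
  have hxy' : ∀ x' ∈ closure Ω, ∀ y' ∈ closure Ω,
      T x' - T' y' - (‖x' - y' - ε • e‖ ^ 2 / ε ^ 2 + ‖y' - z‖ ^ 2) ≤
      T x - T' y - (‖x - y - ε • e‖ ^ 2 / ε ^ 2 + ‖y - z‖ ^ 2) :=
    fun x' hx' y' hy' => hxy (a := (x', y')) ⟨hx', hy'⟩
  set P := ‖x - y - ε • e‖ ^ 2 / ε ^ 2 with hP
  have hP0 : 0 ≤ P := by positivity
  have hPε : ‖x - y - ε • e‖ ^ 2 = ε ^ 2 * P := by rw [hP]; field_simp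
  have hεe : ‖ε • e‖ = ε * ‖e‖ := by rw [norm_smul, Real.norm_of_nonneg hε0.le]
  -- the penalization is small
  have hpen1 : m - η / 2 < T x - T' y - (P + ‖y - z‖ ^ 2) := by
    have hzε : z + ε • e ∈ closure Ω :=
      subset_closure (hcone z hz (by simpa using hr) ε hε0 hε1 (mem_ball_self (by positivity)))
    have h1 := hxy' (z + ε • e) hzε z hz
    have h2 := hTω (z + ε • e) hzε z hz (by
      rw [dist_eq_norm, add_sub_cancel_left, hεe]
      refine lt_of_le_of_lt ?_ hε2
      have : 0 ≤ A := Real.sqrt_nonneg _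
      gcongr
      linarith)
    rw [Real.dist_eq, abs_lt] at h2
    rw [add_sub_cancel_left, sub_self, sub_self, norm_zero] at h1
    norm_num at h1
    linarith
  have hPB : P ≤ B + B' + η := by
    have h1 := (abs_le.1 (hB x hx)).2
    have h2 := (abs_le.1 (hB' y hy)).1
    have h3 := sq_nonneg ‖y - z‖
    linarith
  have hle : ∀ b, 0 ≤ b → P ≤ b ^ 2 → ‖x - y - ε • e‖ ≤ ε * b := by
    intro b hb hPb
    refine (pow_le_pow_iff_left₀ (norm_nonneg _) (by positivity) two_ne_zero).1 ?_
    rw [hPε, mul_pow]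
    gcongr
  have hxyω : dist x y < ω := by
    have h1 := hle A (Real.sqrt_nonneg _) (by rwa [hA, Real.sq_sqrt (hP0.trans hPB)])
    rw [dist_eq_norm, show x - y = (x - y - ε • e) + ε • e by abel]
    refine (norm_add_le _ _).trans_lt ?_
    rw [hεe]
    linarith
  have hpen : P + ‖y - z‖ ^ 2 < η := by
    have h1 := hTω x hx y hy hxyω
    rw [Real.dist_eq, abs_lt] at h1
    linarith [hzmax' y hy]
  have hyz : dist y z < ρ / 2 := by
    rw [dist_eq_norm]
    refine lt_of_pow_lt_pow_left₀ 2 (by positivity) ?_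
    have : η ≤ ρ ^ 2 / 16 := min_le_right _ _
    nlinarith
  have hPκ : P < κ ^ 2 := by
    have : η ≤ κ ^ 2 := min_le_left _ _
    nlinarith [sq_nonneg ‖y - z‖]
  have hshift : ‖x - y - ε • e‖ < ε * κ := by
    refine lt_of_pow_lt_pow_left₀ 2 (by positivity) ?_
    rw [hPε, mul_pow]
    gcongr
  -- so `x` is an interior point, and neither point is the source
  have hxΩ : x ∈ Ω := by
    refine hcone y hy (by linarith) ε hε0 hε1 ?_
    rwa [mem_ball, dist_eq_norm, ← sub_sub, mul_comm]
  have hxz : dist x z < ρ := by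
    have h1 : dist x y ≤ ε * κ + ε * ‖e‖ := by
      rw [dist_eq_norm, show x - y = (x - y - ε • e) + ε • e by abel]
      refine (norm_add_le _ _).trans ?_
      rw [hεe]
      linarith
    linarith [dist_triangle x y z]
  have hne : ∀ w, dist w z < ρ → w ≠ x₀ := by
    rintro w hw rfl
    rw [dist_comm] at hw
    linarith
  -- the viscosity inequalities at `x` and `y` have almost the same gradient
  have hsub := h.subsolution x hxΩ (hne x hxz) _
    (contDiff_sq_dist_add (1 / ε ^ 2) 0 (y + ε • e) z) (by
      refine IsMaxOn.localize fun x' hx' => ?_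
      have := hxy' x' (subset_closure hx') y hy
      simp only [Set.mem_ofPred_eq, zero_mul, add_zero, ← sub_sub, hP] at this ⊢
      linear_combination this)
  have hsup := h'.supersolution y hy (hne y (by linarith)) _
    (contDiff_sq_dist_add (-(1 / ε ^ 2)) (-1) (x - ε • e) z) (by
      refine IsMinOn.localize fun y' hy' => ?_
      have := hxy' x hx y' hy'
      have hsw (w : E d) : ‖w - (x - ε • e)‖ = ‖x - w - ε • e‖ := by
        rw [← norm_neg]
        congr 1
        abel
      simp only [Set.mem_ofPred_eq, hsw, hP] at this ⊢
      linear_combination this)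
  rw [gradient_sq_dist_add] at hsub hsup
  have hgrad : (2 * -(1 / ε ^ 2)) • (y - (x - ε • e)) + (2 * (-1 : ℝ)) • (y - z) =
      ((2 * (1 / ε ^ 2)) • (x - (y + ε • e)) + (2 * (0 : ℝ)) • (x - z)) -
        (2 : ℝ) • (y - z) := by
    module
  rw [hgrad] at hsup
  have h1 := hsup.trans (norm_sub_le _ _)
  rw [norm_smul, Real.norm_of_nonneg zero_le_two, ← dist_eq_norm y z] at h1
  have h2 := hρs x hx y hy hxz (by linarith)
  linarith

/-- Comparison up to a factor. The non-strict inequality is the limit of strict ones for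
`l' ↓ l`. -/
theorem IsEikonalSolution.le_mul {Ω : Set (E d)} (hΩ : IsLipschitzDomain Ω)
    (hbdd : Bornology.IsBounded Ω) {x₀ : E d} {s s' T T' : E d → ℝ}
    (h : IsEikonalSolution Ω x₀ s T) (h' : IsEikonalSolution Ω x₀ s' T')
    (hs : ContinuousOn s (closure Ω)) (hs' : ContinuousOn s' (closure Ω))
    (hpos : ∀ x ∈ closure Ω, 0 < s' x) {l : ℝ} (hl : 0 < l)
    (hle : ∀ x ∈ closure Ω, s x ≤ l * s' x) : ∀ x ∈ closure Ω, T x ≤ l * T' x := by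
  intro x hx
  have hc : Tendsto (fun l' => l' * T' x) (𝓝[>] l) (𝓝 (l * T' x)) :=
    ((continuous_id.mul continuous_const).tendsto l).mono_left nhdsWithin_le_nhds
  refine ge_of_tendsto hc (eventually_mem_nhdsWithin.mono fun l' (hl' : l < l') => ?_)
  refine h.le_of_lt hΩ hbdd (h'.const_mul (hl.trans hl')) hs (continuousOn_const.mul hs')
    (fun y hy => (hle y hy).trans_lt ?_) x hx
  have := hpos y hy
  gcongr

/-- A travel time is bounded by the bound of the slowness times the constant `C` of
`IsLipschitzDomain.exists_osc_bound`. -/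
lemma IsEikonalSolution.abs_le {Ω : Set (E d)} (hΩ : IsOpen Ω) {x₀ : E d} (hx₀ : x₀ ∈ Ω)
    {s T : E d → ℝ} (h : IsEikonalSolution Ω x₀ s T) {C M : ℝ} (hM : 0 ≤ M)
    (hs : ∀ x ∈ Ω, s x ≤ M)
    (hC : ∀ (f : E d → ℝ) (L : ℝ), 0 ≤ L →
      (∀ a b, segment ℝ a b ⊆ Ω → |f a - f b| ≤ L * ‖a - b‖) →
      ∀ x ∈ Ω, ∀ y ∈ Ω, |f x - f y| ≤ C * L) :
    ∀ x ∈ closure Ω, |T x| ≤ C * M := by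
  have hΩb : ∀ x ∈ Ω, |T x| ≤ C * M := fun x hx => by
    simpa [h.source] using
      hC T M hM (fun a b hab => h.abs_sub_le_of_segment hΩ hM hs hab) x hx x₀ hx₀
  intro x hx
  exact le_on_closure hΩb h.continuousOn.abs continuousOn_const hx

/-! ### Stability with respect to the parameter -/

lemma supNorm_nonneg (Ω : Set (E d)) (f : E d → ℝ) : 0 ≤ supNorm Ω f := ENNReal.toReal_nonneg

lemma ae_abs_le_supNorm {Ω : Set (E d)} {f : E d → ℝ} (hf : MemLp f ∞ (volume.restrict Ω)) :
    ∀ᵐ x ∂(volume.restrict Ω), |f x| ≤ supNorm Ω f := by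
  have htop : eLpNormEssSup f (volume.restrict Ω) ≠ ∞ := by
    rw [← eLpNorm_exponent_top]
    exact hf.eLpNorm_ne_top
  filter_upwards [enorm_ae_le_eLpNormEssSup f (volume.restrict Ω)] with x hx
  rw [supNorm, eLpNorm_exponent_top, ← Real.norm_eq_abs, ← toReal_enorm]
  exact ENNReal.toReal_mono htop hx

lemma le_on_closure_of_ae_le {Ω : Set (E d)} (hΩ : IsOpen Ω) {f g : E d → ℝ}
    (hf : ContinuousOn f (closure Ω)) (hg : ContinuousOn g (closure Ω))
    (h : ∀ᵐ x ∂(volume.restrict Ω), f x ≤ g x) : ∀ x ∈ closure Ω, f x ≤ g x := by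
  have hf' := hf.mono subset_closure
  have hg' := hg.mono subset_closure
  -- equality of continuous functions passes from almost everywhere to everywhere on open sets
  have heq : Set.EqOn (fun x => max (f x) (g x)) g Ω :=
    Measure.eqOn_open_of_ae_eq (μ := volume) (h.mono fun x hx => max_eq_right hx) hΩ
      (hf'.sup hg') hg'
  exact fun x hx => le_on_closure (fun y hy => max_eq_right_iff.1 (heq hy)) hf hg hx

lemma U.summable_sub {Ω : Set (E d)} {ψ : ℕ → E d → ℝ} (u v : U Ω ψ) :
    Summable fun i => |u.1 i - v.1 i| * supNorm Ω (ψ i) := by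
  have hu : Summable fun i => |u.1 i| * supNorm Ω (ψ i) := u.2
  have hv : Summable fun i => |v.1 i| * supNorm Ω (ψ i) := v.2
  refine (hu.add hv).of_nonneg_of_le
    (fun i => mul_nonneg (abs_nonneg _) (supNorm_nonneg _ _)) fun i => ?_
  rw [← add_mul]
  exact mul_le_mul_of_nonneg_right (abs_sub _ _) (supNorm_nonneg _ _)

lemma wNorm_nonneg (Ω : Set (E d)) (ψ : ℕ → E d → ℝ) (u : ℕ → ℝ) : 0 ≤ wNorm Ω ψ u :=
  tsum_nonneg fun _ => mul_nonneg (abs_nonneg _) (supNorm_nonneg _ _)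

/-- The series in the exponent of the slowness converges absolutely wherever all `|ψ_i|` are
bounded by their essential suprema. -/
lemma summable_and_abs_tsum_le {Ω : Set (E d)} {ψ : ℕ → E d → ℝ} {x : E d}
    (hx : ∀ i, |ψ i x| ≤ supNorm Ω (ψ i)) {u : ℕ → ℝ} (hu : u ∈ U Ω ψ) :
    Summable (fun i => u i * ψ i x) ∧ |∑' i, u i * ψ i x| ≤ wNorm Ω ψ u := by
  have hle : ∀ i, ‖u i * ψ i x‖ ≤ |u i| * supNorm Ω (ψ i) := fun i => by
    rw [norm_mul, Real.norm_eq_abs, Real.norm_eq_abs]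
    exact mul_le_mul_of_nonneg_left (hx i) (abs_nonneg _)
  exact ⟨Summable.of_norm_bounded hu hle, tsum_of_norm_bounded hu.hasSum hle⟩

lemma abs_exp_sub_exp_le (a b : ℝ) :
    |Real.exp a - Real.exp b| ≤ |a - b| * (Real.exp a + Real.exp b) := by
  have key : ∀ a b : ℝ, Real.exp a - Real.exp b ≤ |a - b| * (Real.exp a + Real.exp b) := by
    intro a b
    have h1 : Real.exp a * (b - a + 1) ≤ Real.exp b := by
      calc Real.exp a * (b - a + 1) ≤ Real.exp a * Real.exp (b - a) := by
            gcongr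
            exact Real.add_one_le_exp _
        _ = Real.exp b := by rw [← Real.exp_add]; ring_nf
    have h2 : (a - b) * Real.exp a ≤ |a - b| * Real.exp a := by
      gcongr
      exact le_abs_self _
    have h3 : 0 ≤ |a - b| * Real.exp b := by positivity
    linarith
  rw [abs_sub_le_iff]
  refine ⟨key a b, ?_⟩
  rw [abs_sub_comm, add_comm]
  exact key b a

/-- The pointwise two-sided bounds of the slowness and its dependence on the parameter. -/
lemma ae_slowness_bounds {Ω : Set (E d)} {sstar sbar : E d → ℝ} {ψ : ℕ → E d → ℝ}
    (hsstar : MemLp sstar ∞ (volume.restrict Ω)) (hsbar : MemLp sbar ∞ (volume.restrict Ω))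
    (hsstar_nonneg : ∀ᵐ x ∂(volume.restrict Ω), 0 ≤ sstar x)
    (hψ : ∀ i, MemLp (ψ i) ∞ (volume.restrict Ω)) (u v : U Ω ψ) :
    ∀ᵐ x ∂(volume.restrict Ω),
      Real.exp (-(supNorm Ω sbar + wNorm Ω ψ v)) ≤ slowness sstar sbar ψ x v ∧
      slowness sstar sbar ψ x v ≤
        (supNorm Ω sstar + Real.exp (supNorm Ω sbar)) * Real.exp (wNorm Ω ψ v) ∧
      slowness sstar sbar ψ x u ≤ slowness sstar sbar ψ x v +
        Real.exp (supNorm Ω sbar) * (∑' i, |u.1 i - v.1 i| * supNorm Ω (ψ i)) *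
          (Real.exp (wNorm Ω ψ u) + Real.exp (wNorm Ω ψ v)) := by
  filter_upwards [ae_abs_le_supNorm hsstar, ae_abs_le_supNorm hsbar, hsstar_nonneg,
    ae_all_iff.2 fun i => ae_abs_le_supNorm (hψ i)] with x h1 h2 h3 h4
  obtain ⟨hsu, hu⟩ := summable_and_abs_tsum_le h4 u.2
  obtain ⟨hsv, hv⟩ := summable_and_abs_tsum_le h4 v.2
  have hdiff : |∑' i, u.1 i * ψ i x - ∑' i, v.1 i * ψ i x| ≤
      ∑' i, |u.1 i - v.1 i| * supNorm Ω (ψ i) := by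
    rw [← hsu.tsum_sub hsv, ← Real.norm_eq_abs]
    refine tsum_of_norm_bounded (U.summable_sub u v).hasSum fun i => ?_
    rw [← sub_mul, norm_mul, Real.norm_eq_abs, Real.norm_eq_abs]
    exact mul_le_mul_of_nonneg_left (h4 i) (abs_nonneg _)
  set a := ∑' i, u.1 i * ψ i x
  set b := ∑' i, v.1 i * ψ i x
  have hb := abs_le.1 hv
  have hs := abs_le.1 h2
  refine ⟨?_, ?_, ?_⟩
  · have : Real.exp (-(supNorm Ω sbar + wNorm Ω ψ v)) ≤ Real.exp (sbar x + b) :=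
      Real.exp_le_exp.2 (by linarith)
    simp only [slowness]
    linarith
  · have he : Real.exp (sbar x + b) ≤ Real.exp (supNorm Ω sbar) * Real.exp (wNorm Ω ψ v) := by
      rw [← Real.exp_add]
      exact Real.exp_le_exp.2 (by linarith)
    have h5 : supNorm Ω sstar ≤ supNorm Ω sstar * Real.exp (wNorm Ω ψ v) :=
      le_mul_of_one_le_right (supNorm_nonneg _ _) (Real.one_le_exp (wNorm_nonneg _ _ _))
    have h6 := le_of_abs_le h1
    simp only [slowness]
    linarith
  · have h5 : Real.exp a - Real.exp b ≤ (∑' i, |u.1 i - v.1 i| * supNorm Ω (ψ i)) *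
        (Real.exp (wNorm Ω ψ u) + Real.exp (wNorm Ω ψ v)) := by
      refine (le_abs_self _).trans ((abs_exp_sub_exp_le a b).trans ?_)
      exact mul_le_mul hdiff (add_le_add (Real.exp_le_exp.2 (le_of_abs_le hu))
        (Real.exp_le_exp.2 (le_of_abs_le hv))) (by positivity) ((abs_nonneg _).trans hdiff)
    have h6 : 0 ≤ (∑' i, |u.1 i - v.1 i| * supNorm Ω (ψ i)) *
        (Real.exp (wNorm Ω ψ u) + Real.exp (wNorm Ω ψ v)) :=
      mul_nonneg ((abs_nonneg _).trans hdiff) (by positivity)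
    have h7 : Real.exp (sbar x) * (Real.exp a - Real.exp b) ≤ Real.exp (supNorm Ω sbar) *
        ((∑' i, |u.1 i - v.1 i| * supNorm Ω (ψ i)) *
        (Real.exp (wNorm Ω ψ u) + Real.exp (wNorm Ω ψ v))) :=
      (mul_le_mul_of_nonneg_left h5 (Real.exp_nonneg _)).trans
        (mul_le_mul_of_nonneg_right (Real.exp_le_exp.2 (le_of_abs_le h2)) h6)
    have h8 : slowness sstar sbar ψ x u = sstar x + Real.exp (sbar x) * Real.exp a := by
      rw [← Real.exp_add]
      rfl
    have h9 : slowness sstar sbar ψ x v = sstar x + Real.exp (sbar x) * Real.exp b := by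
      rw [← Real.exp_add]
      rfl
    rw [h8, h9]
    linarith

/-- Stability of the travel time with respect to the parameter; the constant depends on the
coefficients only through the constant of `IsLipschitzDomain.exists_osc_bound`, `‖s_*‖` and
`‖s̄‖`. -/
theorem exists_stability_constant {Ω : Set (E d)} (hΩ : IsLipschitzDomain Ω)
    (hbdd : Bornology.IsBounded Ω) {sstar sbar : E d → ℝ}
    (hsstar : MemLp sstar ∞ (volume.restrict Ω)) (hsbar : MemLp sbar ∞ (volume.restrict Ω))
    (hsstar_nonneg : ∀ᵐ x ∂(volume.restrict Ω), 0 ≤ sstar x) :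
    ∃ c : ℝ, 0 < c ∧ ∀ x₀ ∈ Ω, ∀ ψ : ℕ → E d → ℝ, (∀ i, MemLp (ψ i) ∞ (volume.restrict Ω)) →
      (∀ u ∈ U Ω ψ, ContinuousOn (fun x => slowness sstar sbar ψ x u) (closure Ω)) →
      ∀ T : E d → U Ω ψ → ℝ, (∀ u : U Ω ψ, IsEikonalSolution Ω x₀
        (fun x => slowness sstar sbar ψ x u) (fun x => T x u)) →
      ∀ x ∈ closure Ω, ∀ u v : U Ω ψ, |T x u - T x v| ≤
        c * (∑' i, |u.1 i - v.1 i| * supNorm Ω (ψ i)) *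
          (Real.exp (wNorm Ω ψ u) + Real.exp (wNorm Ω ψ v)) *
          (Real.exp (2 * wNorm Ω ψ u) + Real.exp (2 * wNorm Ω ψ v)) := by
  obtain ⟨C, hC0, hC⟩ := hΩ.exists_osc_bound hbdd
  set S := supNorm Ω sstar
  set B := supNorm Ω sbar
  have hS : 0 ≤ S := supNorm_nonneg _ _
  set c := C * (S + Real.exp B) * Real.exp (2 * B) with hc
  have hc0 : 0 ≤ c := by positivity
  -- nothing excludes `C = 0`
  refine ⟨c + 1, by positivity, fun x₀ hx₀ ψ hψ hcont T hT x hx => ?_⟩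
  have key : ∀ u v : U Ω ψ, T x u - T x v ≤ c * (∑' i, |u.1 i - v.1 i| * supNorm Ω (ψ i)) *
      (Real.exp (wNorm Ω ψ u) + Real.exp (wNorm Ω ψ v)) * Real.exp (2 * wNorm Ω ψ v) := by
    intro u v
    have hae := ae_slowness_bounds hsstar hsbar hsstar_nonneg hψ u v
    have hlow := le_on_closure_of_ae_le hΩ.isOpen continuousOn_const (hcont v v.2)
      (hae.mono fun _ h => h.1)
    have hupp := le_on_closure_of_ae_le hΩ.isOpen (hcont v v.2) continuousOn_const
      (hae.mono fun _ h => h.2.1)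
    have hdiff := le_on_closure_of_ae_le hΩ.isOpen (hcont u u.2)
      ((hcont v v.2).add continuousOn_const) (hae.mono fun _ h => h.2.2)
    set D := ∑' i, |u.1 i - v.1 i| * supNorm Ω (ψ i)
    have hD : 0 ≤ D := tsum_nonneg fun _ => mul_nonneg (abs_nonneg _) (supNorm_nonneg _ _)
    set Ex := Real.exp (wNorm Ω ψ u) + Real.exp (wNorm Ω ψ v)
    have hEx : 0 ≤ Ex := by positivity
    -- `Λ` is the bound of the difference of the slownesses divided by the lower bound of the second
    set Λ := Real.exp B * D * Ex * Real.exp (B + wNorm Ω ψ v) with hΛ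
    have hΛ0 : 0 ≤ Λ := by positivity
    have hle : ∀ y ∈ closure Ω,
        slowness sstar sbar ψ y u ≤ (1 + Λ) * slowness sstar sbar ψ y v := by
      intro y hy
      have h1 : Real.exp B * D * Ex ≤ Λ * slowness sstar sbar ψ y v := by
        calc Real.exp B * D * Ex = Λ * Real.exp (-(B + wNorm Ω ψ v)) := by
              rw [hΛ, mul_assoc _ (Real.exp (B + _)), ← Real.exp_add, add_neg_cancel,
                Real.exp_zero, mul_one]
          _ ≤ _ := by
              gcongr
              exact hlow y hy
      have h2 : slowness sstar sbar ψ y u ≤ slowness sstar sbar ψ y v + Real.exp B * D * Ex :=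
        hdiff y hy
      linarith
    have hTle := (hT u).le_mul hΩ hbdd (hT v) (hcont u u.2) (hcont v v.2)
      (fun y hy => (Real.exp_pos _).trans_le (hlow y hy)) (by positivity) hle x hx
    have hTabs := (hT v).abs_le hΩ.isOpen hx₀ (by positivity)
      (fun y hy => hupp y (subset_closure hy)) hC x hx
    calc T x u - T x v ≤ Λ * T x v := by linarith
      _ ≤ Λ * (C * ((S + Real.exp B) * Real.exp (wNorm Ω ψ v))) := by
          gcongr
          exact le_of_abs_le hTabs
      _ = c * D * Ex * Real.exp (2 * wNorm Ω ψ v) := by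
          rw [hΛ, hc, two_mul B, two_mul (wNorm Ω ψ v), Real.exp_add, Real.exp_add, Real.exp_add]
          ring
  have hsymm : ∀ u v : U Ω ψ, T x u - T x v ≤
      (c + 1) * (∑' i, |u.1 i - v.1 i| * supNorm Ω (ψ i)) *
        (Real.exp (wNorm Ω ψ u) + Real.exp (wNorm Ω ψ v)) *
        (Real.exp (2 * wNorm Ω ψ u) + Real.exp (2 * wNorm Ω ψ v)) := by
    intro u v
    have hD : 0 ≤ ∑' i, |u.1 i - v.1 i| * supNorm Ω (ψ i) :=
      tsum_nonneg fun _ => mul_nonneg (abs_nonneg _) (supNorm_nonneg _ _)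
    refine (key u v).trans ?_
    gcongr
    · linarith
    · linarith [Real.exp_pos (2 * wNorm Ω ψ u)]
  intro u v
  rw [abs_sub_le_iff]
  refine ⟨hsymm u v, ?_⟩
  have h := hsymm v u
  rwa [tsum_congr fun i => by rw [abs_sub_comm], add_comm (Real.exp (wNorm Ω ψ v)),
    add_comm (Real.exp (2 * wNorm Ω ψ v))] at h

/-! ### The prior, and measurability of the forward map -/

lemma U_eq_setOf_tsum_ne_top (Ω : Set (E d)) (ψ : ℕ → E d → ℝ) :
    U Ω ψ = {u | ∑' i, ENNReal.ofReal (|u i| * supNorm Ω (ψ i)) ≠ ∞} := by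
  ext u
  have h0 : ∀ i, 0 ≤ |u i| * supNorm Ω (ψ i) :=
    fun i => mul_nonneg (abs_nonneg _) (supNorm_nonneg _ _)
  refine ⟨fun hu => Summable.tsum_ofReal_ne_top hu, fun hu => ?_⟩
  change Summable fun i => |u i| * supNorm Ω (ψ i)
  simpa only [ENNReal.toReal_ofReal (h0 _)] using ENNReal.summable_toReal hu

lemma measurableSet_U (Ω : Set (E d)) (ψ : ℕ → E d → ℝ) : MeasurableSet (U Ω ψ) := by
  rw [U_eq_setOf_tsum_ne_top]
  refine (measurableSet_singleton ∞).compl.preimage (Measurable.tsum fun i => ?_)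
  exact (((measurable_pi_apply i).norm).mul_const _).ennreal_ofReal

/-- If the norms `‖ψ_i‖` are summable, then `E ∑ |u_i| ‖ψ_i‖ < ∞`, so `U` has full measure. -/
lemma ae_mem_U {Ω : Set (E d)} {ψ : ℕ → E d → ℝ} (hb : Summable fun i => supNorm Ω (ψ i)) :
    ∀ᵐ u ∂(Measure.infinitePi fun _ : ℕ => gaussianReal 0 1), u ∈ U Ω ψ := by
  rw [U_eq_setOf_tsum_ne_top]
  have hmeas : ∀ i, Measurable fun u : ℕ → ℝ => ENNReal.ofReal (|u i| * supNorm Ω (ψ i)) :=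
    fun i => (((measurable_pi_apply i).norm).mul_const _).ennreal_ofReal
  refine (ae_lt_top (Measurable.tsum hmeas) ?_).mono fun u hu => hu.ne
  rw [lintegral_tsum fun i => (hmeas i).aemeasurable]
  set m := ∫⁻ t : ℝ, ENNReal.ofReal |t| ∂(gaussianReal 0 1) with hm
  have hm_top : m ≠ ∞ := by
    have h : Integrable (fun t : ℝ => t) (gaussianReal 0 1) := IsGaussian.integrable_fun_id
    simpa [hm, ← Real.norm_eq_abs] using h.2.ne
  have hterm : ∀ i, ∫⁻ u : ℕ → ℝ, ENNReal.ofReal (|u i| * supNorm Ω (ψ i))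
      ∂(Measure.infinitePi fun _ : ℕ => gaussianReal 0 1) =
      m * ENNReal.ofReal (supNorm Ω (ψ i)) := by
    intro i
    rw [(measurePreserving_eval_infinitePi (fun _ : ℕ => gaussianReal 0 1) i).lintegral_comp
      (f := fun t : ℝ => ENNReal.ofReal (|t| * supNorm Ω (ψ i))) (by fun_prop)]
    simp only [ENNReal.ofReal_mul (abs_nonneg _)]
    rw [lintegral_mul_const _ (by fun_prop)]
  simp only [hterm]
  rw [ENNReal.tsum_mul_left]
  exact ENNReal.mul_ne_top hm_top hb.tsum_ofReal_ne_top

lemma isProbabilityMeasure_prior {Ω : Set (E d)} {ψ : ℕ → E d → ℝ}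
    (hb : Summable fun i => supNorm Ω (ψ i)) : IsProbabilityMeasure (prior Ω ψ) := by
  refine ⟨?_⟩
  rw [prior, comap_subtype_coe_apply (measurableSet_U Ω ψ), Set.image_univ,
    Subtype.range_coe]
  exact prob_compl_eq_zero_iff (measurableSet_U Ω ψ) |>.1 (ae_mem_U hb)

/-- The truncation of a sequence to its first `n` terms, as an element of `U`. -/
def truncate (Ω : Set (E d)) (ψ : ℕ → E d → ℝ) (n : ℕ) (u : ℕ → ℝ) : U Ω ψ :=
  ⟨fun i => if i < n then u i else 0, summable_of_ne_finset_zero (s := Finset.range n)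
    fun i hi => by
    simp [Finset.mem_range.not.1 hi]⟩

lemma wNorm_truncate (Ω : Set (E d)) (ψ : ℕ → E d → ℝ) (n : ℕ) (u : ℕ → ℝ) :
    wNorm Ω ψ (truncate Ω ψ n u) = ∑ i ∈ Finset.range n, |u i| * supNorm Ω (ψ i) := by
  rw [wNorm, tsum_eq_sum (s := Finset.range n) fun i hi => by
    simp [truncate, Finset.mem_range.not.1 hi]]
  refine Finset.sum_congr rfl fun i hi => ?_
  simp [truncate, Finset.mem_range.1 hi]

/-- A function on `U` that is locally Lipschitz for the weighted norm is measurable for the trace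
of the product `σ`-algebra: it is the limit of its compositions with the truncations, which depend
continuously on finitely many coordinates. -/
lemma measurable_of_stability {Ω : Set (E d)} {ψ : ℕ → E d → ℝ} {F : U Ω ψ → ℝ} {c : ℝ}
    (hF : ∀ u v : U Ω ψ, |F u - F v| ≤ c * (∑' i, |u.1 i - v.1 i| * supNorm Ω (ψ i)) *
      (Real.exp (wNorm Ω ψ u) + Real.exp (wNorm Ω ψ v)) *
      (Real.exp (2 * wNorm Ω ψ u) + Real.exp (2 * wNorm Ω ψ v))) : Measurable F := by
  have hcont : ∀ n, Continuous fun u : ℕ → ℝ => F (truncate Ω ψ n u) := by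
    intro n
    rw [continuous_iff_continuousAt]
    intro v
    have hdist : ∀ u : ℕ → ℝ, ∑' i, |(truncate Ω ψ n u).1 i - (truncate Ω ψ n v).1 i| *
        supNorm Ω (ψ i) = ∑ i ∈ Finset.range n, |u i - v i| * supNorm Ω (ψ i) := by
      intro u
      rw [tsum_eq_sum (s := Finset.range n) fun i hi => by
        simp [truncate, Finset.mem_range.not.1 hi]]
      refine Finset.sum_congr rfl fun i hi => ?_
      simp [truncate, Finset.mem_range.1 hi]
    have hle := fun u : ℕ → ℝ => hF (truncate Ω ψ n u) (truncate Ω ψ n v)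
    simp only [hdist, wNorm_truncate] at hle
    refine tendsto_iff_dist_tendsto_zero.2 (squeeze_zero (fun _ => dist_nonneg) hle ?_)
    refine (Continuous.tendsto' ?_ v _ ?_)
    · fun_prop
    · simp
  have hmeas : ∀ n, Measurable fun u : U Ω ψ => F (truncate Ω ψ n u) :=
    fun n => (hcont n).measurable.comp measurable_subtype_coe
  refine measurable_of_tendsto_metrizable hmeas (tendsto_pi_nhds.2 fun u => ?_)
  have hu : Summable fun i => |u.1 i| * supNorm Ω (ψ i) := u.2
  have hpart : Tendsto (fun n => ∑ i ∈ Finset.range n, |u.1 i| * supNorm Ω (ψ i)) atTop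
      (𝓝 (wNorm Ω ψ u)) := hu.hasSum.tendsto_sum_nat
  have hdist : ∀ n, ∑' i, |(truncate Ω ψ n u).1 i - u.1 i| * supNorm Ω (ψ i) =
      wNorm Ω ψ u - ∑ i ∈ Finset.range n, |u.1 i| * supNorm Ω (ψ i) := by
    intro n
    rw [wNorm, ← hu.sum_add_tsum_nat_add n, add_sub_cancel_left,
      ← (U.summable_sub (truncate Ω ψ n u) u).sum_add_tsum_nat_add n,
      Finset.sum_eq_zero fun i hi => by simp [truncate, Finset.mem_range.1 hi], zero_add]
    simp [truncate]
  have hle := fun n : ℕ => hF (truncate Ω ψ n u) u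
  simp only [hdist, wNorm_truncate] at hle
  refine tendsto_iff_dist_tendsto_zero.2 (squeeze_zero (fun _ => dist_nonneg) hle ?_)
  set g : ℝ → ℝ := fun t => c * (wNorm Ω ψ u - t) * (Real.exp t + Real.exp (wNorm Ω ψ u)) *
    (Real.exp (2 * t) + Real.exp (2 * wNorm Ω ψ u)) with hg
  have hgc : Continuous g := by fun_prop
  have hg0 : g (wNorm Ω ψ u) = 0 := by simp [hg]
  exact hg0 ▸ (hgc.tendsto _).comp hpart

lemma summable_supNorm {Ω : Set (E d)} {ψ : ℕ → E d → ℝ} {C p : ℝ} (hp : 1 < p)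
    (h : ∀ i : ℕ, supNorm Ω (ψ i) < C * ((i : ℝ) + 1) ^ (-p)) :
    Summable fun i => supNorm Ω (ψ i) := by
  have h1 : Summable fun i : ℕ => ((i + 1 : ℕ) : ℝ) ^ (-p) :=
    (summable_nat_add_iff 1).2 (Real.summable_nat_rpow.2 (by linarith))
  refine (h1.mul_left C).of_nonneg_of_le (fun i => supNorm_nonneg _ _) fun i => ?_
  push_cast
  exact (h i).le

lemma measurable_forwardMap {N : ℕ} {V : Type*} [MeasurableSpace V] {T : E d → V → ℝ}
    {obs : Fin N → E d} (hT : ∀ i, Measurable (T (obs i))) : Measurable (forwardMap T obs) :=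
  (WithLp.measurable_toLp 2 _).comp (measurable_pi_lambda _ hT)

/-! ### Gaussian densities and the posterior -/

lemma map_withDensity_comp {α β : Type*} [MeasurableSpace α] [MeasurableSpace β] (μ : Measure α)
    {e : α → β} (he : Measurable e) {g : β → ℝ≥0∞} (hg : Measurable g) :
    (μ.withDensity (g ∘ e)).map e = (μ.map e).withDensity g := by
  ext s hs
  rw [Measure.map_apply he hs, withDensity_apply _ (he hs), withDensity_apply _ hs,
    setLIntegral_map hs hg he]
  rfl

lemma pi_gaussianReal_eq_withDensity (ι : Type*) [Fintype ι] :
    Measure.pi (fun _ : ι => gaussianReal 0 1) =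
      (volume : Measure (ι → ℝ)).withDensity
        fun x => ENNReal.ofReal (∏ i, gaussianPDFReal 0 1 (x i)) := by
  refine Measure.pi_eq fun s hs => ?_
  rw [withDensity_apply _ (MeasurableSet.univ_pi hs), volume_pi, Measure.restrict_pi_pi,
    ← ofReal_integral_eq_lintegral_ofReal, integral_fintype_prod_eq_prod,
    ENNReal.ofReal_prod_of_nonneg]
  · exact Finset.prod_congr rfl fun i _ =>
      (gaussianReal_apply_eq_integral 0 one_ne_zero (s i)).symm
  · exact fun i _ => integral_nonneg fun _ => gaussianPDFReal_nonneg _ _ _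
  · exact Integrable.fintype_prod fun i => (integrable_gaussianPDFReal 0 1).restrict
  · exact ae_of_all _ fun x => Finset.prod_nonneg fun i _ => gaussianPDFReal_nonneg _ _ _

lemma exists_stdGaussian_eq_withDensity (N : ℕ) :
    ∃ k : ℝ≥0∞, stdGaussian (E N) =
      volume.withDensity fun x : E N => k * ENNReal.ofReal (Real.exp (-(1 / 2 * ‖x‖ ^ 2))) := by
  refine ⟨ENNReal.ofReal ((√(2 * Real.pi))⁻¹ ^ N), ?_⟩
  rw [← map_pi_eq_stdGaussian, pi_gaussianReal_eq_withDensity,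
    ← (PiLp.volume_preserving_toLp (Fin N)).map_eq,
    ← map_withDensity_comp _ (WithLp.measurable_toLp 2 _) (by fun_prop)]
  congr 2
  ext x
  rw [Function.comp_apply, ← ENNReal.ofReal_mul (by positivity)]
  congr 1
  simp only [gaussianPDFReal, Finset.prod_mul_distrib, Finset.prod_const, Finset.card_univ,
    Fintype.card_fin, NNReal.coe_one, mul_one, sub_zero, ← Real.exp_sum,
    EuclideanSpace.real_norm_sq_eq, Finset.mul_sum, ← Finset.sum_neg_distrib]
  congr 2
  refine Finset.sum_congr rfl fun i _ => ?_
  ring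

/-- A nondegenerate centred Gaussian has a density proportional to `exp (-½ xᵀ Cov⁻¹ x)`. -/
lemma exists_multivariateGaussian_eq_withDensity {N : ℕ} {Cov : Matrix (Fin N) (Fin N) ℝ}
    (hCov : Cov.PosDef) :
    ∃ k : ℝ≥0∞, multivariateGaussian 0 Cov = volume.withDensity fun x : E N =>
      k * ENNReal.ofReal (Real.exp (-(1 / 2 * (x.ofLp ⬝ᵥ (Cov⁻¹ *ᵥ x.ofLp))))) := by
  obtain ⟨k, hstd⟩ := exists_stdGaussian_eq_withDensity N
  open scoped MatrixOrder in
  set A := CFC.sqrt Cov with hA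
  have hAA : A * A = Cov := CFC.sqrt_mul_sqrt_self _ hCov.posSemidef.nonneg
  have hAT : Aᵀ = A := by
    have : A.IsHermitian := (CFC.sqrt_nonneg Cov).isSelfAdjoint
    simpa using this.eq
  have hdetC : IsUnit Cov.det := hCov.det_pos.ne'.isUnit
  have hdetA : IsUnit A.det := by
    rw [← hAA, Matrix.det_mul] at hdetC
    exact isUnit_of_mul_isUnit_left hdetC
  set L : E N →L[ℝ] E N := Matrix.toEuclideanCLM (𝕜 := ℝ) A with hL
  have hLdet : LinearMap.det (L : E N →ₗ[ℝ] E N) ≠ 0 := by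
    set L' : E N →L[ℝ] E N := Matrix.toEuclideanCLM (𝕜 := ℝ) A⁻¹ with hL'
    have h1 : L * L' = 1 := by
      rw [hL, hL', ← map_mul, Matrix.mul_nonsing_inv _ hdetA, map_one]
    have h2 : (L : E N →ₗ[ℝ] E N) * (L' : E N →ₗ[ℝ] E N) = 1 := by
      ext1 x
      exact congrArg (fun f : E N →L[ℝ] E N => f x) h1
    have h3 := congrArg LinearMap.det h2
    rw [map_mul, map_one] at h3
    exact left_ne_zero_of_mul_eq_one h3
  have hmap : (volume : Measure (E N)).map L =
      ENNReal.ofReal |(LinearMap.det (L : E N →ₗ[ℝ] E N))⁻¹| • volume :=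
    Measure.map_linearMap_addHaar_eq_smul_addHaar volume hLdet
  set k' := ENNReal.ofReal |(LinearMap.det (L : E N →ₗ[ℝ] E N))⁻¹|
  refine ⟨k' * k, ?_⟩
  set g : E N → ℝ≥0∞ := fun x =>
    k * ENNReal.ofReal (Real.exp (-(1 / 2 * (x.ofLp ⬝ᵥ (Cov⁻¹ *ᵥ x.ofLp))))) with hg
  have hgm : Measurable g := by
    have : Continuous fun x : E N => x.ofLp ⬝ᵥ (Cov⁻¹ *ᵥ x.ofLp) := by
      simp only [dotProduct, Matrix.mulVec]
      fun_prop
    exact ((by fun_prop : Continuous fun x : E N =>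
      Real.exp (-(1 / 2 * (x.ofLp ⬝ᵥ (Cov⁻¹ *ᵥ x.ofLp))))).measurable.ennreal_ofReal).const_mul k
  -- `Cov⁻¹ = A⁻¹ A⁻¹` turns the quadratic form at `A x` into `‖x‖²`
  have hcomp : (fun x : E N => k * ENNReal.ofReal (Real.exp (-(1 / 2 * ‖x‖ ^ 2)))) = g ∘ L := by
    ext x
    have hquad : (L x).ofLp ⬝ᵥ (Cov⁻¹ *ᵥ (L x).ofLp) = ‖x‖ ^ 2 := by
      have h1 : (L x).ofLp = A *ᵥ x.ofLp := Matrix.ofLp_toEuclideanCLM A x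
      have h2 : Cov⁻¹ *ᵥ (A *ᵥ x.ofLp) = A⁻¹ *ᵥ x.ofLp := by
        rw [Matrix.mulVec_mulVec, ← hAA, Matrix.mul_inv_rev, mul_assoc,
          Matrix.nonsing_inv_mul _ hdetA, mul_one]
      rw [h1, h2, Matrix.dotProduct_mulVec, ← Matrix.vecMul_transpose, hAT, Matrix.vecMul_vecMul,
        Matrix.mul_nonsing_inv _ hdetA, Matrix.vecMul_one, EuclideanSpace.real_norm_sq_eq]
      exact Finset.sum_congr rfl fun i _ => (sq _).symm
    simp only [hg, Function.comp_apply, hquad]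
  have hfun : (fun x : E N => 0 + L x) = L := by
    ext1 x
    rw [zero_add]
  rw [multivariateGaussian, ← hA, ← hL, hfun, hstd, hcomp,
    map_withDensity_comp _ L.continuous.measurable hgm, hmap, withDensity_smul_measure,
    ← withDensity_smul _ hgm]
  congr 1
  ext x
  simp only [hg, Pi.smul_apply, smul_eq_mul, mul_assoc]

section Bayes

variable {N : ℕ} {V : Type*} [MeasurableSpace V] {μ : Measure V} {Cov : Matrix (Fin N) (Fin N) ℝ}
  {G : V → E N}

omit [MeasurableSpace V] in
lemma misfit_nonneg (hCov : Cov.PosDef) (G : V → E N) (u : V) (δ : E N) :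
    0 ≤ misfit Cov G u δ := by
  have := hCov.inv.posSemidef.dotProduct_mulVec_nonneg (δ - G u).ofLp
  simp only [star_trivial] at this
  exact mul_nonneg (by norm_num) this

lemma measurable_misfit (hG : Measurable G) :
    Measurable fun p : E N × V => misfit Cov G p.2 p.1 := by
  have hq : Continuous fun x : E N => (1 / 2) * (x.ofLp ⬝ᵥ (Cov⁻¹ *ᵥ x.ofLp)) := by
    simp only [dotProduct, Matrix.mulVec]
    fun_prop
  exact hq.measurable.comp (measurable_fst.sub (hG.comp measurable_snd))

/-- The density of the joint law of `(δ, u)` with respect to the product of the Lebesgue measure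
and the prior. -/
lemma exists_jointLaw_eq_withDensity [IsProbabilityMeasure μ] (hG : Measurable G)
    (hCov : Cov.PosDef) :
    ∃ k : ℝ≥0∞, jointLaw μ Cov G = ((volume : Measure (E N)).prod μ).withDensity
      fun p => k * ENNReal.ofReal (Real.exp (-misfit Cov G p.2 p.1)) := by
  obtain ⟨k, hgauss⟩ := exists_multivariateGaussian_eq_withDensity hCov
  refine ⟨k, ?_⟩
  set g : E N × V → ℝ≥0∞ := fun p => k * ENNReal.ofReal (Real.exp (-misfit Cov G p.2 p.1)) with hg
  have hgm : Measurable g := ((measurable_misfit hG).neg.exp.ennreal_ofReal).const_mul k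
  set e : V × E N → E N × V := fun q => (G q.1 + q.2, q.1) with he
  have hem : Measurable e := ((hG.comp measurable_fst).add measurable_snd).prodMk measurable_fst
  have hmp : (μ.prod (volume : Measure (E N))).map e = (volume : Measure (E N)).prod μ := by
    have h1 : MeasurePreserving (fun q : V × E N => (q.1, G q.1 + q.2))
        (μ.prod volume) (μ.prod volume) :=
      (MeasurePreserving.id μ).skew_product (g := fun u θ => G u + θ)
        ((hG.comp measurable_fst).add measurable_snd)
        (ae_of_all _ fun u => map_add_left_eq_self volume (G u))
    exact (Measure.measurePreserving_swap.comp h1).map_eq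
  have hq : Measurable fun x : E N =>
      k * ENNReal.ofReal (Real.exp (-(1 / 2 * (x.ofLp ⬝ᵥ (Cov⁻¹ *ᵥ x.ofLp))))) := by
    have : Continuous fun x : E N => Real.exp (-(1 / 2 * (x.ofLp ⬝ᵥ (Cov⁻¹ *ᵥ x.ofLp)))) := by
      simp only [dotProduct, Matrix.mulVec]
      fun_prop
    exact this.measurable.ennreal_ofReal.const_mul k
  rw [jointLaw, hgauss, prod_withDensity_right hq, ← hmp, ← map_withDensity_comp _ hem hgm]
  congr 2
  ext q
  simp only [Function.comp_apply, hg, he, misfit, add_sub_cancel_left]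

/-- The normalization constant `Z(δ)`. -/
noncomputable def evidence (μ : Measure V) (Cov : Matrix (Fin N) (Fin N) ℝ) (G : V → E N)
    (δ : E N) : ℝ :=
  ∫ w, Real.exp (-misfit Cov G w δ) ∂μ

lemma integrable_exp_neg_misfit [IsProbabilityMeasure μ] (hG : Measurable G) (hCov : Cov.PosDef)
    (δ : E N) : Integrable (fun u => Real.exp (-misfit Cov G u δ)) μ := by
  refine Integrable.of_bound (C := 1)
    ((measurable_misfit hG).comp measurable_prodMk_left).neg.exp.aestronglyMeasurable
    (ae_of_all _ fun u => ?_)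
  rw [Real.norm_of_nonneg (Real.exp_nonneg _), Real.exp_le_one_iff]
  linarith [misfit_nonneg hCov G u δ]

lemma evidence_pos [IsProbabilityMeasure μ] (hG : Measurable G) (hCov : Cov.PosDef) (δ : E N) :
    0 < evidence μ Cov G δ :=
  integral_exp_pos (integrable_exp_neg_misfit hG hCov δ)

lemma lintegral_exp_neg_misfit [IsProbabilityMeasure μ] (hG : Measurable G) (hCov : Cov.PosDef)
    (δ : E N) : ∫⁻ u, ENNReal.ofReal (Real.exp (-misfit Cov G u δ)) ∂μ =
      ENNReal.ofReal (evidence μ Cov G δ) :=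
  (ofReal_integral_eq_lintegral_ofReal (integrable_exp_neg_misfit hG hCov δ)
    (ae_of_all _ fun _ => Real.exp_nonneg _)).symm

lemma measurable_evidence [IsProbabilityMeasure μ] (hG : Measurable G) :
    Measurable (evidence μ Cov G) :=
  ((measurable_misfit hG).neg.exp.stronglyMeasurable.integral_prod_right).measurable

/-- The posterior density `e^{-Φ(u,δ)} / Z(δ)` with respect to the prior. -/
noncomputable def posteriorDensity (μ : Measure V) (Cov : Matrix (Fin N) (Fin N) ℝ) (G : V → E N)
    (δ : E N) (u : V) : ℝ≥0∞ :=
  ENNReal.ofReal (Real.exp (-misfit Cov G u δ) / evidence μ Cov G δ)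

lemma measurable_posteriorDensity [IsProbabilityMeasure μ] (hG : Measurable G) :
    Measurable (Function.uncurry (posteriorDensity μ Cov G)) :=
  ((measurable_misfit hG).neg.exp.div ((measurable_evidence hG).comp measurable_fst)).ennreal_ofReal

/-- Bayes' theorem for additive nondegenerate Gaussian noise. The density formula for the posterior
holds for every `δ`. -/
theorem exists_posterior [MeasurableSpace.CountablyGenerated V] [IsProbabilityMeasure μ]
    (hG : Measurable G) (hCov : Cov.PosDef) :
    ∃ κ : Kernel (E N) V, IsPosterior μ Cov G κ ∧
      (∀ δ, κ δ ≪ μ ∧ (κ δ).rnDeriv μ =ᵐ[μ] posteriorDensity μ Cov G δ) ∧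
      ∀ κ' : Kernel (E N) V, IsPosterior μ Cov G κ' →
        ∀ᵐ δ ∂(jointLaw μ Cov G).fst, κ' δ = κ δ := by
  have hρ := measurable_posteriorDensity (μ := μ) (Cov := Cov) hG
  have hρ' : Measurable fun p : E N × V => posteriorDensity μ Cov G p.1 p.2 := hρ
  have hexp : Measurable fun p : E N × V =>
      ENNReal.ofReal (Real.exp (-misfit Cov G p.2 p.1)) :=
    (measurable_misfit hG).neg.exp.ennreal_ofReal
  have hexpδ : ∀ δ, Measurable fun u => ENNReal.ofReal (Real.exp (-misfit Cov G u δ)) :=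
    fun δ => ((measurable_misfit hG).comp (measurable_prodMk_left (x := δ))).neg.exp.ennreal_ofReal
  set κ : Kernel (E N) V := (Kernel.const (E N) μ).withDensity (posteriorDensity μ Cov G) with hκ
  have hκδ : ∀ δ, κ δ = μ.withDensity (posteriorDensity μ Cov G δ) := fun δ => by
    rw [hκ, Kernel.withDensity_apply _ hρ, Kernel.const_apply]
  have hZpos := evidence_pos (μ := μ) hG hCov
  have hκM : IsMarkovKernel κ := by
    refine ⟨fun δ => ⟨?_⟩⟩
    rw [hκδ, withDensity_apply _ MeasurableSet.univ, Measure.restrict_univ]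
    simp only [posteriorDensity, div_eq_mul_inv, ENNReal.ofReal_mul (Real.exp_nonneg _)]
    rw [lintegral_mul_const _ (hexpδ δ), lintegral_exp_neg_misfit hG hCov,
      ← ENNReal.ofReal_mul (hZpos δ).le,
      mul_inv_cancel₀ (hZpos δ).ne', ENNReal.ofReal_one]
  have hJ : IsProbabilityMeasure (jointLaw μ Cov G) :=
    Measure.isProbabilityMeasure_map
      (((hG.comp measurable_fst).add measurable_snd).prodMk measurable_fst).aemeasurable
  obtain ⟨k, hjoint⟩ := exists_jointLaw_eq_withDensity (μ := μ) hG hCov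
  have hZm : Measurable fun δ => k * ENNReal.ofReal (evidence μ Cov G δ) :=
    (measurable_evidence hG).ennreal_ofReal.const_mul k
  have hfst : (jointLaw μ Cov G).fst =
      volume.withDensity fun δ => k * ENNReal.ofReal (evidence μ Cov G δ) := by
    ext t ht
    rw [Measure.fst_apply ht, hjoint, withDensity_apply _ (measurable_fst ht),
      withDensity_apply _ ht, ← Set.prod_univ, ← Measure.prod_restrict, Measure.restrict_univ,
      lintegral_prod _ (hexp.const_mul k).aemeasurable]
    refine lintegral_congr fun δ => ?_
    rw [lintegral_const_mul _ (hexpδ δ), lintegral_exp_neg_misfit hG hCov]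
  have hZm' : Measurable fun p : E N × V => k * ENNReal.ofReal (evidence μ Cov G p.1) :=
    ((measurable_evidence hG).comp measurable_fst).ennreal_ofReal.const_mul k
  have hcomp : (jointLaw μ Cov G).fst ⊗ₘ κ = jointLaw μ Cov G := by
    rw [hκ, Measure.compProd_withDensity hρ, Measure.compProd_const, hfst,
      prod_withDensity_left hZm, ← withDensity_mul _ hZm' hρ', hjoint]
    congr 1
    ext ⟨δ, u⟩
    simp only [Pi.mul_apply, posteriorDensity, mul_assoc]
    rw [← ENNReal.ofReal_mul (hZpos δ).le, mul_div_cancel₀ _ (hZpos δ).ne']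
  have hdens : ∀ δ, κ δ ≪ μ ∧ (κ δ).rnDeriv μ =ᵐ[μ] posteriorDensity μ Cov G δ := fun δ => by
    rw [hκδ]
    exact ⟨withDensity_absolutelyContinuous _ _, Measure.rnDeriv_withDensity _ hρ.of_uncurry_left⟩
  refine ⟨κ, ⟨hκM, hcomp⟩, hdens, fun κ' hκ' => ?_⟩
  have := hκ'.1
  exact Kernel.ae_eq_of_compProd_eq (hκ'.2.trans hcomp.symm)

end Bayes

end LogNormalEikonal

theorem mainTheorem3 {d : ℕ} (Ω : Set (LogNormalEikonal.E d))
    (hΩ : LogNormalEikonal.IsLipschitzDomain Ω) (hbdd : Bornology.IsBounded Ω)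
    (sstar sbar : LogNormalEikonal.E d → ℝ)
    (hsstar : MemLp sstar ∞ (volume.restrict Ω)) (hsbar : MemLp sbar ∞ (volume.restrict Ω))
    (hsstar_nonneg : ∀ᵐ x ∂(volume.restrict Ω), 0 ≤ sstar x) :
    -- `c` depends only on `Ω`, `s_*` and `s̄`
    ∃ c : ℝ, 0 < c ∧
      ∀ x₀ ∈ Ω, ∀ ψ : ℕ → LogNormalEikonal.E d → ℝ,
        (∀ i, MemLp (ψ i) ∞ (volume.restrict Ω)) →
        (∃ C p : ℝ, 0 < C ∧ 1 < p ∧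
          ∀ i : ℕ, LogNormalEikonal.supNorm Ω (ψ i) < C * ((i : ℝ) + 1) ^ (-p)) →
        (∀ u ∈ LogNormalEikonal.U Ω ψ,
          ContinuousOn (fun x => LogNormalEikonal.slowness sstar sbar ψ x u) (closure Ω)) →
      ∀ T : LogNormalEikonal.E d → LogNormalEikonal.U Ω ψ → ℝ,
        (∀ u : LogNormalEikonal.U Ω ψ, LogNormalEikonal.IsEikonalSolution Ω x₀
          (fun x => LogNormalEikonal.slowness sstar sbar ψ x u) (fun x => T x u)) →
      -- stability of the solution with respect to the parameter
      (∀ x ∈ closure Ω, ∀ u v : LogNormalEikonal.U Ω ψ,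
        |T x u - T x v| ≤
          c * (∑' i, |u.1 i - v.1 i| * LogNormalEikonal.supNorm Ω (ψ i)) *
            (Real.exp (LogNormalEikonal.wNorm Ω ψ u) + Real.exp (LogNormalEikonal.wNorm Ω ψ v)) *
            (Real.exp (2 * LogNormalEikonal.wNorm Ω ψ u) +
              Real.exp (2 * LogNormalEikonal.wNorm Ω ψ v))) ∧
      -- the prior is a probability measure on `U`
      IsProbabilityMeasure (LogNormalEikonal.prior Ω ψ) ∧
      ∀ (N : ℕ) (obs : Fin N → LogNormalEikonal.E d), (∀ i, obs i ∈ closure Ω) →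
        -- the forward map is measurable
        Measurable (LogNormalEikonal.forwardMap T obs) ∧
        ∀ Cov : Matrix (Fin N) (Fin N) ℝ, Cov.PosDef →
          -- the posterior exists, for all data it is absolutely continuous with respect to the
          -- prior, with density proportional to `exp (-Φ)`, and it is unique up to null sets
          ∃ κ : Kernel (LogNormalEikonal.E N) (LogNormalEikonal.U Ω ψ),
            LogNormalEikonal.IsPosterior (LogNormalEikonal.prior Ω ψ) Cov
              (LogNormalEikonal.forwardMap T obs) κ ∧
            (∀ δ : LogNormalEikonal.E N,
              κ δ ≪ LogNormalEikonal.prior Ω ψ ∧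
              0 < ∫ u, Real.exp (-LogNormalEikonal.misfit Cov
                (LogNormalEikonal.forwardMap T obs) u δ) ∂(LogNormalEikonal.prior Ω ψ) ∧
              (κ δ).rnDeriv (LogNormalEikonal.prior Ω ψ) =ᵐ[LogNormalEikonal.prior Ω ψ]
                fun u => ENNReal.ofReal
                  (Real.exp (-LogNormalEikonal.misfit Cov
                      (LogNormalEikonal.forwardMap T obs) u δ) /
                    ∫ w, Real.exp (-LogNormalEikonal.misfit Cov
                      (LogNormalEikonal.forwardMap T obs) w δ) ∂(LogNormalEikonal.prior Ω ψ))) ∧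
            ∀ κ' : Kernel (LogNormalEikonal.E N) (LogNormalEikonal.U Ω ψ),
              LogNormalEikonal.IsPosterior (LogNormalEikonal.prior Ω ψ) Cov
                (LogNormalEikonal.forwardMap T obs) κ' →
              ∀ᵐ δ ∂(LogNormalEikonal.jointLaw (LogNormalEikonal.prior Ω ψ) Cov
                (LogNormalEikonal.forwardMap T obs)).fst, κ' δ = κ δ := by
  obtain ⟨c, hc, hstab⟩ := LogNormalEikonal.exists_stability_constant hΩ hbdd hsstar hsbar
    hsstar_nonneg
  refine ⟨c, hc, fun x₀ hx₀ ψ hψ hdecay hcont T hT => ?_⟩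
  obtain ⟨C, p, -, hp, hCp⟩ := hdecay
  have hTstab := hstab x₀ hx₀ ψ hψ hcont T hT
  have hprior := LogNormalEikonal.isProbabilityMeasure_prior
    (LogNormalEikonal.summable_supNorm hp hCp)
  refine ⟨hTstab, hprior, fun N obs hobs => ?_⟩
  have hG : Measurable (LogNormalEikonal.forwardMap T obs) :=
    LogNormalEikonal.measurable_forwardMap fun i =>
      LogNormalEikonal.measurable_of_stability (hTstab (obs i) (hobs i))
  refine ⟨hG, fun Cov hCov => ?_⟩
  obtain ⟨κ, hκ, hdens, huniq⟩ := LogNormalEikonal.exists_posterior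
    (μ := LogNormalEikonal.prior Ω ψ) hG hCov
  exact ⟨κ, hκ, fun δ => ⟨(hdens δ).1, LogNormalEikonal.evidence_pos hG hCov δ, (hdens δ).2⟩,
    huniq⟩
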